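/- Let $\mathbb N=\{0,1,2,\dots\}$ and $n\ge 1$. Let $r,s\ge 0$ and let $\eta=(n_1,\dots,n_r;m_1,\dots,m_s)$ be positive integers with $n_1+\dots+n_r+2(m_1+\dots+m_s)=n$. Let $\mathbb T_m(\mathbb R)$ be the set of lower triangular real $m\times m$ matrices with constant diagonal. Let $\mathbb B_m(\mathbb R)$ be the set of real $2m\times 2m$ matrices which are block lower triangular with $2\times2$ blocks of the form $\begin{bmatrix}\alpha&\beta\\-\beta&\alpha\end{bmatrix}$ $(\alpha,\beta\in\mathbb R)$ and whose diagonal blocks are all equal. Put $$\mathcal K=\mathcal K_{\eta,r,s}(\mathbb R)=\mathbb T_{n_1}(\mathbb R)\oplus\dots\oplus\mathbb T_{n_r}(\mathbb R)\oplus\mathbb B_{m_1}(\mathbb R)\oplus\dots\oplus\mathbb B_{m_s}(\mathbb R)\subset M_n(\mathbb R).$$ Let $G$ be an abelian sub-semigroup of $M_n(\mathbb R)$ and $P\in\mathrm{GL}(n,\mathbb R)$ with $P^{-1}GP\subset\mathcal K$. For a set $S$ of matrices and $v\in\mathbb R^n$ write $S(v)=\{Av: A\in S\}$; $G$ is called hypercyclic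 if $G(v)$ is dense in $\mathbb R^n$ for some $v\in\mathbb R^n$. Put $$\mathrm g=\{B\in P\mathcal KP^{-1}: e^B\in G\},\qquad \mathrm g^2=\{B\in P\mathcal KP^{-1}: e^B=A^2\text{ for some }A\in G\}.$$ Let $u_0\in\mathbb R^n$ be the vector whose coordinates are $1$ at the first place of each of the $r+s$ blocks (of sizes $n_1,\dots,n_r,2m_1,\dots,2m_s$) and $0$ elsewhere, and $v_0=Pu_0$. For $1\le l\le s$ let $f^{(l)}\in\mathbb R^n$ be the standard basis vector at the second place of the $l$-th of the last $s$ blocks (the block of size $2m_l$). For $M\in P\mathcal KP^{-1}$ let $\mu_k(M)$ $(1\le k\le r)$ be the eigenvalue of the $k$-th block, in $\mathbb T_{n_k}(\mathbb R)$, of $P^{-1}MP$. Let $\mathrm{ind}(G)$ be the number of $k\in\{1,\dots,r\}$ for which there is an invertible $M\in G$ with $\mu_k(M)<0$ and $\mu_i(M)>0$ for all $i\ne k$. Suppose that $A_1,\dots,A_p$ generate $G$ (either as a semigroup, or as a semigroup together with the identity matrix $I_n$), and that $B_1,\dots,B_p\in\mathrm g$ satisfy $A_k^2=e^{B_k}$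 for $k=1,\dots,p$. Then the following are equivalent: (i) $G$ is hypercyclic; (ii) $G(v_0)$ is dense in $\mathbb R^n$; (iii) $\mathrm g^2_{v_0}:=\{Bv_0: B\in\mathrm g^2\}$ is dense in $\mathbb R^n$ and $\mathrm{ind}(G)=r$; (iv) the additive semigroup $\displaystyle\sum_{k=1}^p\mathbb N B_kv_0+\sum_{l=1}^s2\pi\mathbb Z\,Pf^{(l)}$ is dense in $\mathbb R^n$ and $\mathrm{ind}(G)=r$. Moreover, if $I_n\in G$, then $\mathrm g^2_{v_0}=\displaystyle\sum_{k=1}^p\mathbb N B_kv_0+\sum_{l=1}^s2\pi\mathbb Z\,Pf^{(l)}$. -/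

import Mathlib

namespace MatrixSemigroup

/-- A sequence `η = (n₁, …, n_r; m₁, …, m_s)` of positive integers with
`(n₁ + ⋯ + n_r) + 2 (m₁ + ⋯ + m_s) = n`; `r = 0` and `s = 0` are allowed. -/
structure BlockType (n r s : ℕ) where
  realSize : Fin r → ℕ
  cplxSize : Fin s → ℕ
  realSize_pos : ∀ k, 0 < realSize k
  cplxSize_pos : ∀ l, 0 < cplxSize l
  sum_eq : ∑ k, realSize k + 2 * ∑ l, cplxSize l = n

/-- The lower triangular real matrices of order `m` with constant diagonal. -/
def triangular (m : ℕ) : Set (Matrix (Fin m) (Fin m) ℝ) :=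
  {M | (∀ i j, i < j → M i j = 0) ∧ ∃ μ : ℝ, ∀ i, M i i = μ}

/-- The set `𝕊` of real matrices `[α, β; -β, α]`. -/
def similitude : Set (Matrix (Fin 2) (Fin 2) ℝ) :=
  {C | ∃ α β : ℝ, C = !![α, β; -β, α]}

/-- The real matrices of order `2 * m` which are block lower triangular, with all `2 × 2` blocks
in `𝕊` and with all diagonal `2 × 2` blocks equal.  The index `(i, a)` stands for the position
`2 * i + a` (counted from `0`), so `fun a b => M (i, a) (j, b)` is the `(i, j)` block of `M`. -/
def cplxTriangular (m : ℕ) : Set (Matrix (Fin m × Fin 2) (Fin m × Fin 2) ℝ) :=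
  {M | (∀ i j, Matrix.of (fun a b => M (i, a) (j, b)) ∈ similitude) ∧
    (∀ i j, i < j → ∀ a b, M (i, a) (j, b) = 0) ∧
    ∃ C : Matrix (Fin 2) (Fin 2) ℝ, ∀ i a b, M (i, a) (i, b) = C a b}

namespace BlockType

variable {n r s : ℕ} (η : BlockType n r s)

/-- The coordinates of `ℝⁿ`, sorted by the blocks of `η`. -/
abbrev Idx : Type :=
  (Σ k : Fin r, Fin (η.realSize k)) ⊕ (Σ l : Fin s, Fin (η.cplxSize l) × Fin 2)

theorem sum_eq' : ∑ k, η.realSize k + ∑ l, η.cplxSize l * 2 = n := by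
  rw [← Finset.sum_mul, mul_comm _ 2]
  exact η.sum_eq

/-- The order preserving numbering of the coordinates: first the real blocks, one after the other,
then the complex blocks, one after the other, with `(i, a)` at place `2 * i + a` of its block. -/
def idxEquiv : η.Idx ≃ Fin n :=
  (Equiv.sumCongr finSigmaFinEquiv
    ((Equiv.sigmaCongrRight fun _ => finProdFinEquiv).trans finSigmaFinEquiv)).trans
    (finSumFinEquiv.trans (finCongr η.sum_eq'))

/-- `𝒦_{η,r,s}(ℝ)`: the block diagonal matrices `diag(T₁, …, T_r; B₁, …, B_s)` of order `n`. -/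
def normalForms : Set (Matrix (Fin n) (Fin n) ℝ) :=
  {M | ∃ (T : ∀ k, Matrix (Fin (η.realSize k)) (Fin (η.realSize k)) ℝ)
      (B : ∀ l, Matrix (Fin (η.cplxSize l) × Fin 2) (Fin (η.cplxSize l) × Fin 2) ℝ),
    (∀ k, T k ∈ triangular (η.realSize k)) ∧ (∀ l, B l ∈ cplxTriangular (η.cplxSize l)) ∧
    M = Matrix.reindex η.idxEquiv η.idxEquiv
      (Matrix.fromBlocks (Matrix.blockDiagonal' T) 0 0 (Matrix.blockDiagonal' B))}

/-- The position of the first coordinate of the `k`-th real block. -/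
def firstReal (k : Fin r) : Fin n := η.idxEquiv (Sum.inl ⟨k, ⟨0, η.realSize_pos k⟩⟩)

/-- For `M = diag(M₁, …, M_r; …)` in `𝒦_{η,r,s}(ℝ)`, the eigenvalue `μ_k` of `M_k`, which is the
common value of the diagonal entries of `M_k`. -/
def realEigenvalue (M : Matrix (Fin n) (Fin n) ℝ) (k : Fin r) : ℝ :=
  M (η.firstReal k) (η.firstReal k)

/-- `u₀`: in every block the first coordinate is `1` and the others are `0`. -/
def u₀ : Fin n → ℝ := fun i =>
  Sum.elim (fun x => if (x.2 : ℕ) = 0 then 1 else 0)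
    (fun x => if (x.2.1 : ℕ) = 0 ∧ x.2.2 = 0 then 1 else 0) (η.idxEquiv.symm i)

/-- `f^{(l)}`: the second coordinate of the `l`-th complex block is `1`, all others are `0`. -/
def f (l : Fin s) : Fin n → ℝ := fun i =>
  Sum.elim (fun _ => 0)
    (fun x => if x.1 = l ∧ (x.2.1 : ℕ) = 0 ∧ x.2.2 = 1 then 1 else 0) (η.idxEquiv.symm i)

/-- `P⁻¹ M P`. -/
def conj (P : GL (Fin n) ℝ) (M : Matrix (Fin n) (Fin n) ℝ) : Matrix (Fin n) (Fin n) ℝ :=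
  (P⁻¹ : GL (Fin n) ℝ).val * M * P.val

/-- `exp⁻¹(S) ∩ P 𝒦_{η,r,s}(ℝ) P⁻¹`; this is `g` for `S = G` and `g²` for `S = G²`. -/
def logs (P : GL (Fin n) ℝ) (S : Set (Matrix (Fin n) (Fin n) ℝ)) :
    Set (Matrix (Fin n) (Fin n) ℝ) :=
  {B | NormedSpace.exp B ∈ S ∧ conj P B ∈ η.normalForms}

/-- The vector `v₀ = P u₀`. -/
def v₀ (P : GL (Fin n) ℝ) : Fin n → ℝ := P.val.mulVec η.u₀

/-- The index `ind(G)`: the number of `k` for which some invertible `M ∈ G` has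
`μ_k(P⁻¹MP) < 0` and `μ_i(P⁻¹MP) > 0` for all `i ≠ k`.  For `r = 0` it is `0`; for `r = 1` the
last condition is void, so that it is `1` if `μ₁ < 0` occurs and `0` otherwise. -/
noncomputable def index (P : GL (Fin n) ℝ) (G : Set (Matrix (Fin n) (Fin n) ℝ)) : ℕ :=
  Set.ncard {k : Fin r | ∃ M ∈ G, IsUnit M ∧ η.realEigenvalue (conj P M) k < 0 ∧
    ∀ i, i ≠ k → 0 < η.realEigenvalue (conj P M) i}

/-- The additive semigroup `∑_{k=1}^p ℕ B_k v₀ + ∑_{l=1}^s 2πℤ P f^{(l)}`. -/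
def sumSemigroup (P : GL (Fin n) ℝ) {p : ℕ} (B : Fin p → Matrix (Fin n) (Fin n) ℝ) :
    AddSubsemigroup (Fin n → ℝ) where
  carrier := {x | ∃ (m : Fin p → ℕ) (t : Fin s → ℤ),
    x = ∑ k, (m k : ℝ) • (B k).mulVec (η.v₀ P) +
      ∑ l, (2 * Real.pi * (t l : ℝ)) • P.val.mulVec (η.f l)}
  add_mem' := by
    rintro _ _ ⟨m, t, rfl⟩ ⟨m', t', rfl⟩
    refine ⟨m + m', t + t', ?_⟩
    simp only [Pi.add_apply, Nat.cast_add, Int.cast_add, mul_add, add_smul,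
      Finset.sum_add_distrib]
    abel

end BlockType

/-- `S(v) = {A v : A ∈ S}`. -/
def orbit {n : ℕ} (S : Set (Matrix (Fin n) (Fin n) ℝ)) (v : Fin n → ℝ) : Set (Fin n → ℝ) :=
  (fun A => A.mulVec v) '' S

/-- `G² = {A² : A ∈ G}`. -/
def squares {n : ℕ} (G : Set (Matrix (Fin n) (Fin n) ℝ)) : Set (Matrix (Fin n) (Fin n) ℝ) :=
  (fun A => A ^ 2) '' G

/-- `G` has a dense orbit in `ℝⁿ`. -/
def IsHypercyclic {n : ℕ} (G : Set (Matrix (Fin n) (Fin n) ℝ)) : Prop :=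
  ∃ v : Fin n → ℝ, Dense (orbit G v)

end MatrixSemigroup

open MatrixSemigroup

namespace MatrixSemigroup

open Filter Topology

/-! ### Linear functionals, polynomial identities and exponentials -/

/-! On the algebra `K` of conjugated normal forms, the leading coordinates of `X v₀` give the
eigenvalues of `X`, as an algebra map onto `ℝ ^ r × ℂ ^ s`. It has a central section `D`, and `X - D
(eig X)` is nilpotent. Only this structure, recorded in `SpectralFrame`, enters the dynamics. It
controls logarithms: a matrix of `K` commuting with `exp Y` commutes with `Y`
(`commute_of_commute_exp`), and two logarithms in `K` of one matrix differ by a period `D (0, 2πi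
t)` (`exists_eq_add_period`).

If a commuting family spans `ℝⁿ` when applied to `v₀`, evaluation at `v₀` identifies its span with
`ℝⁿ` (`exists_cyclicAlgebra`). The exponential then becomes an open map `expVec` of `ℝⁿ`, whose
range is relatively clopen among the vectors with invertible eigenvalues. Hence it contains every
vector with positive real eigenvalues and non-real complex ones (`mem_range_expVec`).

A dense orbit of any `v` is carried to the orbit of `v₀` by an invertible matrix in the span of `G`.
Density at `v₀` makes every sign pattern occur, and openness of `expVec` pulls it back to density of
logarithms of squares. These logarithms are sums of the `B k` plus periods. The converse inclusion
can only miss logarithms of the identity, all of which lie in a hyperplane.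

Conversely, exponentiating a dense set of sums puts every vector with positive real eigenvalues in
the closure of the squares applied to `v₀`. The index condition supplies elements of `G` with all
sign patterns, which move this region to the others (`dense_orbit_of_dense_sumSet`). -/

theorem dense_ne_zero_of_linear {V : Type*} [AddCommGroup V] [Module ℝ V] [TopologicalSpace V]
    [ContinuousAdd V] [ContinuousSMul ℝ V] (φ : V →ₗ[ℝ] ℝ) {v : V} (hv : φ v ≠ 0) :
    Dense {x | φ x ≠ 0} := by
  intro x
  by_cases hx : φ x = 0
  · have h : Tendsto (fun t : ℝ => x + t • v) (𝓝[≠] 0) (𝓝 x) := by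
      have : Continuous fun t : ℝ => x + t • v := by fun_prop
      have h2 := this.tendsto 0
      simp only [zero_smul, add_zero] at h2
      exact h2.mono_left nhdsWithin_le_nhds
    refine mem_closure_of_tendsto h ?_
    filter_upwards [self_mem_nhdsWithin] with t ht
    simpa [hx] using And.intro ht hv
  · exact subset_closure hx

/-- Coordinatewise, a polynomial vanishing at all natural numbers is zero. The linear coefficient is
singled out because `exp N ^ m`, for nilpotent `N`, is polynomial in `m` with linear coefficient
`N`; this recovers `N` without a matrix logarithm. -/
theorem coeff_one_eq_zero_of_forall_nat {E : Type*} [AddCommGroup E] [Module ℝ E]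
    [Module.Finite ℝ E] {d : ℕ} (C : ℕ → E)
    (h : ∀ m : ℕ, ∑ j ∈ Finset.range (d + 2), (m : ℝ) ^ j • C j = 0) : C 1 = 0 := by
  have b := Module.finBasis ℝ E
  apply b.ext_elem
  intro i
  let q : Polynomial ℝ :=
    ∑ j ∈ Finset.range (d + 2), Polynomial.C (b.repr (C j) i) * Polynomial.X ^ j
  have hq : q = 0 := by
    apply Polynomial.eq_zero_of_infinite_isRoot
    refine (Set.infinite_range_of_injective (Nat.cast_injective (R := ℝ))).mono ?_
    rintro _ ⟨m, rfl⟩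
    have := congrArg (fun z => b.repr z i) (h m)
    simp only [map_sum, map_smul, Finsupp.coe_finsetSum, Finset.sum_apply, Finsupp.smul_apply,
      smul_eq_mul, map_zero, Finsupp.zero_apply] at this
    simp only [Set.mem_ofPred_eq, Polynomial.IsRoot, q, Polynomial.eval_finsetSum,
      Polynomial.eval_mul, Polynomial.eval_C, Polynomial.eval_pow, Polynomial.eval_X]
    rw [← this]
    exact Finset.sum_congr rfl fun j _ => mul_comm _ _
  have h1 := congrArg (fun p => Polynomial.coeff p 1) hq
  simpa [q, Polynomial.finsetSum_coeff, Polynomial.coeff_X_pow] using h1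

section Exp

open scoped Matrix.Norms.Operator

variable {ι : Type*} [Fintype ι] [DecidableEq ι]

theorem exp_eq_sum_of_pow_eq_zero {N : Matrix ι ι ℝ} {d : ℕ} (hN : N ^ d = 0) :
    NormedSpace.exp N = ∑ j ∈ Finset.range d, ((j.factorial : ℝ)⁻¹) • N ^ j := by
  rw [NormedSpace.exp_eq_tsum ℝ]
  refine tsum_eq_sum fun j hj => ?_
  rw [pow_eq_zero_of_le (by simpa using hj) hN, smul_zero]

theorem exp_pow_eq_sum_of_pow_eq_zero {N : Matrix ι ι ℝ} {d : ℕ} (hN : N ^ d = 0) (m : ℕ) :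
    NormedSpace.exp N ^ m =
      ∑ j ∈ Finset.range d, (m : ℝ) ^ j • (((j.factorial : ℝ)⁻¹) • N ^ j) := by
  rw [← Matrix.exp_nsmul, exp_eq_sum_of_pow_eq_zero (N := m • N) (d := d)
    (by rw [smul_pow, hN, smul_zero])]
  refine Finset.sum_congr rfl fun j _ => ?_
  rw [smul_pow, ← Nat.cast_smul_eq_nsmul ℝ, smul_comm, Nat.cast_pow]

theorem commute_of_commute_exp_of_isNilpotent {X N : Matrix ι ι ℝ} (hN : IsNilpotent N)
    (h : Commute X (NormedSpace.exp N)) : Commute X N := by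
  obtain ⟨d, hd⟩ := hN
  -- The exponent is raised so that the sum surely contains the term of degree one.
  have hd2 : N ^ (d + 2) = 0 := pow_eq_zero_of_le (by lia) hd
  have key := coeff_one_eq_zero_of_forall_nat (d := d)
    (fun j => ((j.factorial : ℝ)⁻¹) • (X * N ^ j - N ^ j * X)) fun m => by
      have := (h.pow_right m).eq
      rw [exp_pow_eq_sum_of_pow_eq_zero hd2, Finset.mul_sum, Finset.sum_mul, ← sub_eq_zero,
        ← Finset.sum_sub_distrib] at this
      rw [← this]
      refine Finset.sum_congr rfl fun j _ => ?_
      simp only [mul_smul_comm, smul_mul_assoc, smul_sub]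
  have : X * N = N * X := by simpa [sub_eq_zero] using key
  exact this

theorem eq_of_exp_eq_of_isNilpotent {N N' : Matrix ι ι ℝ} (hN : IsNilpotent N)
    (hN' : IsNilpotent N') (h : NormedSpace.exp N = NormedSpace.exp N') : N = N' := by
  obtain ⟨d, hd⟩ := hN
  obtain ⟨d', hd'⟩ := hN'
  have h1 : N ^ (d + d' + 2) = 0 := pow_eq_zero_of_le (by lia) hd
  have h2 : N' ^ (d + d' + 2) = 0 := pow_eq_zero_of_le (by lia) hd'
  have key := coeff_one_eq_zero_of_forall_nat (d := d + d')
    (fun j => ((j.factorial : ℝ)⁻¹) • (N ^ j - N' ^ j)) fun m => by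
      have := congrArg (fun Z => Z ^ m) h
      simp only [exp_pow_eq_sum_of_pow_eq_zero h1, exp_pow_eq_sum_of_pow_eq_zero h2] at this
      rw [← sub_eq_zero, ← Finset.sum_sub_distrib] at this
      rw [← this]
      refine Finset.sum_congr rfl fun j _ => ?_
      simp only [smul_sub]
  simpa [sub_eq_zero] using key

theorem commute_exp_right {X Y : Matrix ι ι ℝ} (h : Commute X Y) :
    Commute X (NormedSpace.exp Y) :=
  h.exp_right

theorem exp_smul_half_sq (X : Matrix ι ι ℝ) :
    NormedSpace.exp ((1 / 2 : ℝ) • X) ^ 2 = NormedSpace.exp X := by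
  rw [← Matrix.exp_nsmul, ← Nat.cast_smul_eq_nsmul ℝ, smul_smul]
  norm_num

theorem continuous_matrix_exp :
    Continuous (NormedSpace.exp : Matrix ι ι ℝ → Matrix ι ι ℝ) :=
  NormedSpace.exp_continuous

/-- The derivative at `0` is `x ↦ Φ x v`, the identity, so the open mapping form of the inverse
function theorem applies. -/
theorem map_nhds_zero_exp_mulVec (Φ : (ι → ℝ) →ₗ[ℝ] Matrix ι ι ℝ) (v : ι → ℝ)
    (hΦ : ∀ x, (Φ x).mulVec v = x) :
    map (fun x => (NormedSpace.exp (Φ x)).mulVec v) (𝓝 0) = 𝓝 v := by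
  let L : Matrix ι ι ℝ →ₗ[ℝ] (ι → ℝ) := (Matrix.mulVecBilin ℝ ℝ).flip v
  have hL : ∀ X, L.toContinuousLinearMap X = X.mulVec v := fun X => rfl
  have h1 : HasStrictFDerivAt (NormedSpace.exp : Matrix ι ι ℝ → Matrix ι ι ℝ)
      (1 : Matrix ι ι ℝ →L[ℝ] Matrix ι ι ℝ) (Φ.toContinuousLinearMap 0) := by
    rw [map_zero]; exact hasStrictFDerivAt_exp_zero
  have h2 := L.toContinuousLinearMap.hasStrictFDerivAt.comp (0 : ι → ℝ)
    (h1.comp (0 : ι → ℝ) Φ.toContinuousLinearMap.hasStrictFDerivAt)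
  have h3 := h2.map_nhds_eq_of_surj (LinearMap.range_eq_top.2 fun x => ⟨x, hΦ x⟩)
  simp only [map_zero, NormedSpace.exp_zero] at h3
  have h4 : L.toContinuousLinearMap (1 : Matrix ι ι ℝ) = v := by rw [hL, Matrix.one_mulVec]
  rw [h4] at h3
  exact h3

end Exp

end MatrixSemigroup

/-! ### Spectral frames: eigenvalues, nilpotent parts and logarithms -/

namespace MatrixSemigroup

open Filter Topology

/-- A matrix algebra `K` whose elements have a Jordan decomposition `X = D (χ (X v₀)) + N` with
`N` nilpotent and with `D` a copy of `ℝ ^ r × ℂ ^ s` in the centre of `K`. -/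
structure SpectralFrame (ι : Type*) [Fintype ι] [DecidableEq ι] (r s : ℕ) where
  K : Subalgebra ℝ (Matrix ι ι ℝ)
  χ : (ι → ℝ) →ₗ[ℝ] (Fin r → ℝ) × (Fin s → ℂ)
  D : ((Fin r → ℝ) × (Fin s → ℂ)) →ₐ[ℝ] Matrix ι ι ℝ
  v₀ : ι → ℝ
  χ_mulVec : ∀ X ∈ K, ∀ v, χ (X.mulVec v) = χ (X.mulVec v₀) * χ v
  D_mem : ∀ a, D a ∈ K
  D_commute : ∀ X ∈ K, ∀ a, Commute (D a) X
  χ_D : ∀ a, χ ((D a).mulVec v₀) = a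
  isNilpotent : ∀ X ∈ K, χ (X.mulVec v₀) = 0 → IsNilpotent X

namespace SpectralFrame

variable {ι : Type*} [Fintype ι] [DecidableEq ι] {r s : ℕ} (F : SpectralFrame ι r s)

/-- The eigenvalues of a matrix in `K`. -/
noncomputable def eig : Matrix ι ι ℝ →ₗ[ℝ] (Fin r → ℝ) × (Fin s → ℂ) :=
  F.χ ∘ₗ (Matrix.mulVecBilin ℝ ℝ).flip F.v₀

theorem eig_apply (X : Matrix ι ι ℝ) : F.eig X = F.χ (X.mulVec F.v₀) := rfl

theorem eig_D (a) : F.eig (F.D a) = a := F.χ_D a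

theorem χ_v₀ : F.χ F.v₀ = 1 := by
  have := F.χ_D 1
  rwa [map_one, Matrix.one_mulVec] at this

theorem eig_one : F.eig 1 = 1 := by rw [eig_apply, Matrix.one_mulVec, χ_v₀]

theorem eig_mul {X : Matrix ι ι ℝ} (hX : X ∈ F.K) (Y : Matrix ι ι ℝ) :
    F.eig (X * Y) = F.eig X * F.eig Y := by
  simp only [eig_apply]
  rw [← Matrix.mulVec_mulVec, F.χ_mulVec X hX]

theorem eig_pow {X : Matrix ι ι ℝ} (hX : X ∈ F.K) (j : ℕ) : F.eig (X ^ j) = F.eig X ^ j := by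
  induction j with
  | zero => simp [eig_one]
  | succ j ih => rw [pow_succ', F.eig_mul hX, ih, pow_succ']

theorem continuous_D : Continuous F.D := F.D.toLinearMap.continuous_of_finiteDimensional

theorem continuous_χ : Continuous F.χ := F.χ.continuous_of_finiteDimensional

open scoped Matrix.Norms.Operator in
theorem exp_D (a) : NormedSpace.exp (F.D a) = F.D (NormedSpace.exp a) :=
  (NormedSpace.map_exp F.D F.continuous_D a).symm

open scoped Matrix.Norms.Operator in
theorem eig_exp {X : Matrix ι ι ℝ} (hX : X ∈ F.K) :
    F.eig (NormedSpace.exp X) = NormedSpace.exp (F.eig X) := by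
  have h1 := NormedSpace.exp_series_hasSum_exp' (𝕂 := ℝ) X
  have h2 := h1.map F.eig F.eig.continuous_of_finiteDimensional
  have h3 := NormedSpace.exp_series_hasSum_exp' (𝕂 := ℝ) (F.eig X)
  have h4 : (F.eig ∘ fun j : ℕ => ((j.factorial : ℝ)⁻¹) • X ^ j) =
      fun j : ℕ => ((j.factorial : ℝ)⁻¹) • F.eig X ^ j := by
    funext j
    rw [Function.comp_apply, map_smul, F.eig_pow hX]
  rw [h4] at h2
  exact h2.unique h3

/-- The nilpotent part of a matrix in `K`. -/
noncomputable def nil (X : Matrix ι ι ℝ) : Matrix ι ι ℝ := X - F.D (F.eig X)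

theorem isNilpotent_nil {X : Matrix ι ι ℝ} (hX : X ∈ F.K) : IsNilpotent (F.nil X) := by
  refine F.isNilpotent _ (F.K.sub_mem hX (F.D_mem _)) ?_
  rw [← eig_apply, nil, map_sub, eig_D, sub_self]

theorem exp_nil {X : Matrix ι ι ℝ} (hX : X ∈ F.K) :
    NormedSpace.exp (F.nil X) = NormedSpace.exp X * NormedSpace.exp (F.D (-F.eig X)) := by
  rw [nil, sub_eq_add_neg, ← map_neg, Matrix.exp_add_of_commute]
  exact (F.D_commute X hX _).symm

/-- Multiplying by `D` of the inverse eigenvalues gives a matrix with all eigenvalues `1`, that is,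
the identity plus a nilpotent. -/
theorem isUnit_of_isUnit_eig {X : Matrix ι ι ℝ} (hX : X ∈ F.K) (h : IsUnit (F.eig X)) :
    IsUnit X := by
  obtain ⟨y, hy⟩ := h.exists_left_inv
  have h1 : IsNilpotent (F.D y * X - 1) := by
    refine F.isNilpotent _ (F.K.sub_mem (F.K.mul_mem (F.D_mem y) hX) F.K.one_mem) ?_
    rw [← eig_apply, map_sub, F.eig_mul (F.D_mem y), eig_D, hy, eig_one, sub_self]
  have h2 : IsUnit (F.D y * X) := by
    have := h1.isUnit_one_add
    rwa [add_sub_cancel] at this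
  exact ((F.D_commute X hX y).isUnit_mul_iff.1 h2).2

/-- The factor `exp (D (-eig Y))` is central in `K`, so the question reduces to the nilpotent part
of `Y`, where the polynomial argument applies. -/
theorem commute_of_commute_exp {X Y : Matrix ι ι ℝ} (hX : X ∈ F.K) (hY : Y ∈ F.K)
    (h : Commute X (NormedSpace.exp Y)) : Commute X Y := by
  have h1 : Commute X (NormedSpace.exp (F.nil Y)) := by
    rw [F.exp_nil hY]
    exact h.mul_right (commute_exp_right (F.D_commute X hX _).symm)
  have h2 := commute_of_commute_exp_of_isNilpotent (F.isNilpotent_nil hY) h1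
  have h3 : Y = F.nil Y + F.D (F.eig Y) := by rw [nil, sub_add_cancel]
  rw [h3]
  exact h2.add_right (F.D_commute X hX _).symm

/-- The element `(0, 2πi t)` of `ℝ ^ r × ℂ ^ s`. -/
noncomputable def period (t : Fin s → ℤ) : (Fin r → ℝ) × (Fin s → ℂ) :=
  (0, fun l => (t l : ℂ) * (2 * Real.pi * Complex.I))

theorem exp_fst (a : (Fin r → ℝ) × (Fin s → ℂ)) (k : Fin r) :
    (NormedSpace.exp a).1 k = Real.exp (a.1 k) := by
  rw [Prod.fst_exp, Pi.coe_exp, Real.exp_eq_exp_ℝ]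

theorem exp_snd (a : (Fin r → ℝ) × (Fin s → ℂ)) (l : Fin s) :
    (NormedSpace.exp a).2 l = Complex.exp (a.2 l) := by
  rw [Prod.snd_exp, Pi.coe_exp, Complex.exp_eq_exp_ℂ]

theorem exp_period (t : Fin s → ℤ) :
    NormedSpace.exp (period t : (Fin r → ℝ) × (Fin s → ℂ)) = 1 := by
  ext l
  · rw [exp_fst]; simp [period]
  · rw [exp_snd]; simp only [period, Complex.exp_int_mul_two_pi_mul_I]; rfl

theorem exp_D_period (t : Fin s → ℤ) : NormedSpace.exp (F.D (period t)) = 1 := by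
  rw [exp_D, exp_period, map_one]

theorem exp_add_D_period {X : Matrix ι ι ℝ} (hX : X ∈ F.K) (t : Fin s → ℤ) :
    NormedSpace.exp (X + F.D (period t)) = NormedSpace.exp X := by
  rw [Matrix.exp_add_of_commute _ _ (F.D_commute X hX _).symm, exp_D_period, mul_one]

theorem exists_eq_add_period {X Y : Matrix ι ι ℝ} (hX : X ∈ F.K) (hY : Y ∈ F.K)
    (h : NormedSpace.exp X = NormedSpace.exp Y) : ∃ t, X = Y + F.D (period t) := by
  have h1 : NormedSpace.exp (F.eig X) = NormedSpace.exp (F.eig Y) := by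
    rw [← F.eig_exp hX, ← F.eig_exp hY, h]
  have hc : ∀ l, ∃ t : ℤ, (F.eig X).2 l = (F.eig Y).2 l + t * (2 * Real.pi * Complex.I) := by
    intro l
    rw [← Complex.exp_eq_exp_iff_exists_int, ← exp_snd, ← exp_snd, h1]
  choose t ht using hc
  have h2 : F.eig X = F.eig Y + period t := by
    ext l
    · have : Real.exp ((F.eig X).1 l) = Real.exp ((F.eig Y).1 l) := by
        rw [← exp_fst, ← exp_fst, h1]
      simpa [period] using Real.exp_injective this
    · exact ht l
  have h3 : F.nil X = F.nil Y := by
    -- The eigenvalues of `X` and `Y` differ by a period, which the exponential does not see; hence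
    -- the unipotent factors coincide as well.
    refine eq_of_exp_eq_of_isNilpotent (F.isNilpotent_nil hX) (F.isNilpotent_nil hY) ?_
    rw [F.exp_nil hX, F.exp_nil hY, h]
    congr 1
    have : -F.eig Y = -F.eig X + period t := by rw [h2]; abel
    rw [this, map_add, F.exp_add_D_period (F.D_mem _)]
  refine ⟨t, ?_⟩
  rw [nil, nil, h2, map_add] at h3
  have := congrArg (fun Z => Z + (F.D (F.eig Y) + F.D (period t))) h3
  simp only [sub_add_cancel] at this
  rw [this]; abel

end SpectralFrame

end MatrixSemigroup

namespace MatrixSemigroup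

open Filter Topology

/-! ### Cyclic vectors of commuting families -/

section Cyclic

variable {ι : Type*} [Fintype ι] [DecidableEq ι]

/-- The kernel of `Z` contains `v` and is stable under `S`, so it contains the whole space. -/
theorem eq_zero_of_commute_of_mulVec_eq_zero {S : Set (Matrix ι ι ℝ)} {v : ι → ℝ}
    (hspan : Submodule.span ℝ ((fun X : Matrix ι ι ℝ => X.mulVec v) '' S) = ⊤)
    {Z : Matrix ι ι ℝ} (hZ : ∀ Y ∈ S, Commute Z Y) (h : Z.mulVec v = 0) : Z = 0 := by
  have h1 : Submodule.span ℝ ((fun X : Matrix ι ι ℝ => X.mulVec v) '' S) ≤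
      LinearMap.ker (Matrix.mulVecLin Z) := by
    rw [Submodule.span_le]
    rintro _ ⟨Y, hY, rfl⟩
    simp only [SetLike.mem_coe, LinearMap.mem_ker, Matrix.mulVecLin_apply, Matrix.mulVec_mulVec]
    rw [(hZ Y hY).eq, ← Matrix.mulVec_mulVec, h, Matrix.mulVec_zero]
  rw [hspan, top_le_iff, LinearMap.ker_eq_top] at h1
  have : Matrix.toLin' Z = 0 := by rw [Matrix.toLin'_apply', h1]
  simpa using this

theorem commute_of_mem_span {S : Set (Matrix ι ι ℝ)} {X Z : Matrix ι ι ℝ}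
    (hX : X ∈ Submodule.span ℝ S) (hZ : ∀ Y ∈ S, Commute Z Y) : Commute Z X := by
  induction hX using Submodule.span_induction with
  | mem x hx => exact hZ x hx
  | zero => exact Commute.zero_right Z
  | add x y _ _ hx hy => exact hx.add_right hy
  | smul a x _ hx => exact hx.smul_right a

end Cyclic

namespace SpectralFrame

variable {ι : Type*} [Fintype ι] [DecidableEq ι] {r s : ℕ} (F : SpectralFrame ι r s)

/-- A commutative subspace of `K` on which evaluation at `v₀` is bijective, given as the inverse of
the evaluation, and containing its commutant. -/
structure CyclicAlgebra where
  Φ : (ι → ℝ) →ₗ[ℝ] Matrix ι ι ℝ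
  mulVec_v₀ : ∀ x, (Φ x).mulVec F.v₀ = x
  mem_K : ∀ x, Φ x ∈ F.K
  commute : ∀ x y, Commute (Φ x) (Φ y)
  Φ_mulVec : ∀ X, (∀ x, Commute X (Φ x)) → Φ (X.mulVec F.v₀) = X

/-- Evaluation at `v₀` is injective on the span of `S` by the preceding kernel argument and
surjective by cyclicity. `Φ` is its inverse. -/
theorem exists_cyclicAlgebra {S : Set (Matrix ι ι ℝ)} (hSK : ∀ X ∈ S, X ∈ F.K)
    (hS : ∀ X ∈ S, ∀ Y ∈ S, Commute X Y)
    (hspan : Submodule.span ℝ ((fun X : Matrix ι ι ℝ => X.mulVec F.v₀) '' S) = ⊤) :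
    ∃ T : F.CyclicAlgebra, ∀ X, (∀ Y ∈ S, Commute X Y) → T.Φ (X.mulVec F.v₀) = X := by
  let ev : Matrix ι ι ℝ →ₗ[ℝ] (ι → ℝ) := (Matrix.mulVecBilin ℝ ℝ).flip F.v₀
  have hev : ∀ X, ev X = X.mulVec F.v₀ := fun X => rfl
  have hc : ∀ X ∈ Submodule.span ℝ S, ∀ Y ∈ S, Commute X Y := fun X hX Y hY =>
    (commute_of_mem_span hX fun Z hZ => hS Y hY Z hZ).symm
  have hinj : Function.Injective (ev.domRestrict (Submodule.span ℝ S)) := by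
    rw [injective_iff_map_eq_zero]
    rintro ⟨X, hX⟩ h
    exact Subtype.ext (eq_zero_of_commute_of_mulVec_eq_zero hspan (hc X hX) h)
  have hsurj : Function.Surjective (ev.domRestrict (Submodule.span ℝ S)) := by
    intro x
    have : x ∈ Submodule.map ev (Submodule.span ℝ S) := by
      rw [Submodule.map_span]
      change x ∈ Submodule.span ℝ ((fun X : Matrix ι ι ℝ => X.mulVec F.v₀) '' S)
      rw [hspan]; trivial
    obtain ⟨X, hX, rfl⟩ := this
    exact ⟨⟨X, hX⟩, rfl⟩
  let e := LinearEquiv.ofBijective (ev.domRestrict (Submodule.span ℝ S)) ⟨hinj, hsurj⟩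
  have he : ∀ x, ((e.symm x : Submodule.span ℝ S) : Matrix ι ι ℝ).mulVec F.v₀ = x := fun x =>
    e.apply_symm_apply x
  have hmem : ∀ x, ((e.symm x : Submodule.span ℝ S) : Matrix ι ι ℝ) ∈ Submodule.span ℝ S :=
    fun x => (e.symm x).2
  have huniq : ∀ X, (∀ Y ∈ S, Commute X Y) →
      ((e.symm (X.mulVec F.v₀) : Submodule.span ℝ S) : Matrix ι ι ℝ) = X := by
    intro X hX
    rw [← sub_eq_zero]
    refine eq_zero_of_commute_of_mulVec_eq_zero hspan
      (fun Y hY => (hc _ (hmem _) Y hY).sub_left (hX Y hY)) ?_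
    rw [Matrix.sub_mulVec, he, sub_self]
  refine ⟨⟨(Submodule.span ℝ S).subtype ∘ₗ e.symm.toLinearMap, he, fun x => ?_, fun x y => ?_,
    fun X hX => huniq X fun Y hY => ?_⟩, huniq⟩
  · exact (Submodule.span_le (p := Subalgebra.toSubmodule F.K)).2 hSK (hmem x)
  · exact commute_of_mem_span (hmem y) (hc _ (hmem x))
  · have := hX (Y.mulVec F.v₀)
    rwa [LinearMap.comp_apply, LinearEquiv.coe_coe, Submodule.subtype_apply,
      huniq Y (hS Y hY)] at this

variable {F} in
theorem map_mulVec_nhds {Y : Matrix ι ι ℝ} (hY : IsUnit Y) (v : ι → ℝ) :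
    map (fun x => Y.mulVec x) (𝓝 v) = 𝓝 (Y.mulVec v) := by
  obtain ⟨u, rfl⟩ := hY
  let h : (ι → ℝ) ≃ₜ (ι → ℝ) :=
    { toFun := fun x => u.val.mulVec x
      invFun := fun x => (u⁻¹).val.mulVec x
      left_inv := fun x => by simp [Matrix.mulVec_mulVec]
      right_inv := fun x => by simp [Matrix.mulVec_mulVec]
      continuous_toFun := by fun_prop
      continuous_invFun := by fun_prop }
  exact h.map_nhds_eq v

/-! ### The exponential map of a cyclic algebra -/

namespace CyclicAlgebra

variable {F} (T : F.CyclicAlgebra)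

/-- The exponential map of the algebra, read in `ℝ ^ ι` by means of evaluation at `v₀`. -/
noncomputable def expVec (x : ι → ℝ) : ι → ℝ := (NormedSpace.exp (T.Φ x)).mulVec F.v₀

theorem continuous_Φ : Continuous T.Φ := T.Φ.continuous_of_finiteDimensional

theorem continuous_expVec : Continuous T.expVec := by
  have := continuous_matrix_exp.comp T.continuous_Φ
  exact this.matrix_mulVec continuous_const

theorem Φ_expVec (x) : T.Φ (T.expVec x) = NormedSpace.exp (T.Φ x) :=
  T.Φ_mulVec _ fun y => (commute_exp_right (T.commute y x)).symm

theorem eig_Φ (x) : F.eig (T.Φ x) = F.χ x := by rw [eig_apply, T.mulVec_v₀]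

theorem isUnit_Φ {x} (h : IsUnit (F.χ x)) : IsUnit (T.Φ x) :=
  F.isUnit_of_isUnit_eig (T.mem_K x) (by rwa [T.eig_Φ])

theorem expVec_add (x y) :
    T.expVec (x + y) = (NormedSpace.exp (T.Φ x)).mulVec (T.expVec y) := by
  rw [expVec, expVec, map_add, Matrix.exp_add_of_commute _ _ (T.commute x y),
    Matrix.mulVec_mulVec]

theorem map_expVec_nhds_zero {Y : Matrix ι ι ℝ} (hY : IsUnit Y) :
    map (fun x => Y.mulVec (T.expVec x)) (𝓝 0) = 𝓝 (Y.mulVec F.v₀) := by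
  rw [← map_mulVec_nhds hY, ← map_nhds_zero_exp_mulVec T.Φ F.v₀ T.mulVec_v₀, map_map]
  rfl

/-- Openness at `0` is transported to `x` by the invertible matrix `exp (Φ x)`, because `expVec (x +
y) = exp (Φ x) (expVec y)`. -/
theorem image_expVec_mem_nhds {x : ι → ℝ} {U : Set (ι → ℝ)} (hU : U ∈ 𝓝 x) :
    T.expVec '' U ∈ 𝓝 (T.expVec x) := by
  have h := T.map_expVec_nhds_zero (Matrix.isUnit_exp (T.Φ x))
  change map _ _ = 𝓝 (T.expVec x) at h
  rw [← h]
  have hU' : (fun y => x + y) ⁻¹' U ∈ 𝓝 (0 : ι → ℝ) := by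
    have : Continuous fun y : ι → ℝ => x + y := by fun_prop
    exact this.continuousAt (by simpa using hU)
  refine mem_map.2 (mem_of_superset hU' fun y hy => ?_)
  exact ⟨x + y, hy, T.expVec_add x y⟩

/-- The range corresponds to an open subgroup of the units of the algebra, so its cosets are open
and it is also relatively closed. If `y` is outside, its translates by small exponentials form a
neighbourhood of `y` that avoids the range. -/
theorem range_or_compl_mem_nhds {y : ι → ℝ} (hy : IsUnit (F.χ y)) :
    (Set.range T.expVec ∈ 𝓝 y ∧ y ∈ Set.range T.expVec) ∨ (Set.range T.expVec)ᶜ ∈ 𝓝 y := by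
  by_cases h : y ∈ Set.range T.expVec
  · left
    refine ⟨?_, h⟩
    obtain ⟨x, rfl⟩ := h
    have := T.image_expVec_mem_nhds (x := x) univ_mem
    rwa [Set.image_univ] at this
  · right
    have h1 := T.map_expVec_nhds_zero (T.isUnit_Φ hy)
    rw [T.mulVec_v₀] at h1
    rw [← h1]
    refine mem_map.2 (univ_mem' fun x => ?_)
    rintro ⟨z, hz⟩
    apply h
    refine ⟨-x + z, ?_⟩
    have hcomm : Commute (NormedSpace.exp (T.Φ (-x))) (T.Φ y) :=
      (commute_exp_right (T.commute y (-x))).symm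
    rw [T.expVec_add, hz, Matrix.mulVec_mulVec, hcomm.eq, ← Matrix.mulVec_mulVec,
      ← T.expVec_add, neg_add_cancel, expVec, map_zero, NormedSpace.exp_zero,
      Matrix.one_mulVec, T.mulVec_v₀]

/-- The segment from `v₀` to `x` never meets a zero eigenvalue: real ones stay positive, and `a + b
z` with `z` non-real and `a + b = 1` is nonzero. As the range is clopen along this segment and
contains `v₀ = expVec 0`, it contains `x`. -/
theorem mem_range_expVec {x : ι → ℝ} (h1 : ∀ k, 0 < (F.χ x).1 k)
    (h2 : ∀ l, ((F.χ x).2 l).im ≠ 0) : x ∈ Set.range T.expVec := by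
  set R := Set.range T.expVec
  have hunit : ∀ y ∈ segment ℝ F.v₀ x, IsUnit (F.χ y) := by
    rintro _ ⟨a, b, ha, hb, hab, rfl⟩
    rw [Prod.isUnit_iff, Pi.isUnit_iff, Pi.isUnit_iff, map_add, map_smul, map_smul, F.χ_v₀]
    refine ⟨fun k => ?_, fun l => ?_⟩
    · rw [isUnit_iff_ne_zero]
      have := h1 k
      simp only [Prod.fst_add, Prod.smul_fst, Prod.fst_one, Pi.add_apply, Pi.smul_apply,
        Pi.one_apply, smul_eq_mul, mul_one]
      rcases eq_or_lt_of_le ha with rfl | ha'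
      · have : b = 1 := by linarith
        subst this; simpa using this.ne'
      · positivity
    · rw [isUnit_iff_ne_zero]
      simp only [Prod.snd_add, Prod.smul_snd, Prod.snd_one, Pi.add_apply, Pi.smul_apply,
        Pi.one_apply]
      intro h0
      have him := congrArg Complex.im h0
      simp only [Complex.add_im, Complex.smul_im, Complex.one_im, mul_zero, zero_add,
        Complex.zero_im, smul_eq_mul, mul_eq_zero, h2 l, or_false] at him
      subst him
      have : a = 1 := by linarith
      subst this
      simp at h0
  have hpre : IsPreconnected (segment ℝ F.v₀ x) := (convex_segment F.v₀ x).isPreconnected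
  have hsub := hpre.subset_left_of_subset_union (u := interior R) (v := interior Rᶜ)
    isOpen_interior isOpen_interior
    (Set.disjoint_of_subset interior_subset interior_subset disjoint_compl_right)
    (fun y hy => by
      rcases T.range_or_compl_mem_nhds (hunit y hy) with h | h
      · exact Or.inl (mem_interior_iff_mem_nhds.2 h.1)
      · exact Or.inr (mem_interior_iff_mem_nhds.2 h))
    ⟨F.v₀, left_mem_segment ℝ _ _, by
      rcases T.range_or_compl_mem_nhds (hunit _ (left_mem_segment ℝ F.v₀ x)) with h | h
      · exact mem_interior_iff_mem_nhds.2 h.1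
      · exfalso
        refine mem_of_mem_nhds h ⟨0, ?_⟩
        rw [expVec, map_zero, NormedSpace.exp_zero, Matrix.one_mulVec]⟩
  exact interior_subset (hsub (right_mem_segment ℝ _ _))

end CyclicAlgebra

end SpectralFrame

end MatrixSemigroup

/-! ### Semigroups in a spectral frame: squares, logarithms and dense orbits -/

namespace MatrixSemigroup

open Filter Topology

theorem span_eq_top_of_dense {V : Type*} [AddCommGroup V] [Module ℝ V] [TopologicalSpace V]
    [IsTopologicalAddGroup V] [ContinuousSMul ℝ V] [T2Space V] [FiniteDimensional ℝ V]
    {S : Set V} (hS : Dense S) : Submodule.span ℝ S = ⊤ := by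
  have h1 : IsClosed (Submodule.span ℝ S : Set V) := Submodule.closed_of_finiteDimensional _
  have h2 := (hS.mono (Submodule.subset_span (R := ℝ))).closure_eq
  rw [h1.closure_eq] at h2
  exact SetLike.coe_injective h2

namespace SpectralFrame

section Powers

variable {ι : Type*} [Fintype ι] [DecidableEq ι] {p : ℕ}

theorem exists_sq_eq_exp_sum_of_mem {G : Subsemigroup (Matrix ι ι ℝ)}
    (hG : ∀ X ∈ G, ∀ Y ∈ G, X * Y = Y * X) {A B : Fin p → Matrix ι ι ℝ}
    (hA : G = Subsemigroup.closure (Set.range A) ∨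
      G = Subsemigroup.closure (insert 1 (Set.range A)))
    (hBB : ∀ i j, Commute (B i) (B j)) (hAB : ∀ k, A k ^ 2 = NormedSpace.exp (B k))
    {X : Matrix ι ι ℝ} (hX : X ∈ G) :
    ∃ m : Fin p → ℕ, X ^ 2 = NormedSpace.exp (∑ k, (m k : ℝ) • B k) := by
  obtain ⟨S, rfl, hS⟩ : ∃ S, G = Subsemigroup.closure S ∧ S ⊆ insert 1 (Set.range A) := by
    rcases hA with h | h
    · exact ⟨_, h, Set.subset_insert _ _⟩
    · exact ⟨_, h, subset_rfl⟩
  induction hX using Subsemigroup.closure_induction with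
  | mem x hx =>
    rcases hS hx with rfl | ⟨k, rfl⟩
    · exact ⟨0, by simp⟩
    · refine ⟨Pi.single k 1, ?_⟩
      rw [hAB, Finset.sum_eq_single k]
      · simp
      · intro j _ hj; simp [hj]
      · simp
  | mul x y hx hy ihx ihy =>
    obtain ⟨a, ha⟩ := ihx
    obtain ⟨b, hb⟩ := ihy
    refine ⟨a + b, ?_⟩
    rw [Commute.mul_pow (hG x hx y hy), ha, hb, ← Matrix.exp_add_of_commute]
    · simp [add_smul, Finset.sum_add_distrib]
    · refine Commute.sum_left _ _ _ fun i _ => Commute.sum_right _ _ _ fun j _ => ?_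
      exact ((hBB i j).smul_left _).smul_right _

theorem mem_of_eq_closure_range {G : Subsemigroup (Matrix ι ι ℝ)} {A : Fin p → Matrix ι ι ℝ}
    (hA : G = Subsemigroup.closure (Set.range A) ∨
      G = Subsemigroup.closure (insert 1 (Set.range A))) (k : Fin p) : A k ∈ G := by
  rcases hA with rfl | rfl
  · exact Subsemigroup.subset_closure ⟨k, rfl⟩
  · exact Subsemigroup.subset_closure (Or.inr ⟨k, rfl⟩)

/-- The submonoid obtained by adjoining the identity to a subsemigroup. -/
def adjoinOne (G : Subsemigroup (Matrix ι ι ℝ)) : Submonoid (Matrix ι ι ℝ) where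
  carrier := {X | X = 1 ∨ X ∈ G}
  one_mem' := Or.inl rfl
  mul_mem' := by
    rintro X Y (rfl | hX) (rfl | hY)
    · simp
    · simpa using Or.inr hY
    · simpa using Or.inr hX
    · exact Or.inr (G.mul_mem hX hY)

theorem mem_adjoinOne {G : Subsemigroup (Matrix ι ι ℝ)} {X : Matrix ι ι ℝ} :
    X ∈ adjoinOne G ↔ X = 1 ∨ X ∈ G := Iff.rfl

theorem commute_of_mem_adjoinOne {G : Subsemigroup (Matrix ι ι ℝ)}
    (hG : ∀ X ∈ G, ∀ Y ∈ G, X * Y = Y * X) {X Y : Matrix ι ι ℝ} (hX : X ∈ adjoinOne G)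
    (hY : Y ∈ adjoinOne G) : Commute X Y := by
  rcases hX with rfl | hX
  · exact Commute.one_left _
  rcases hY with rfl | hY
  · exact Commute.one_right _
  exact hG X hX Y hY

/-- The witness is the product of the `A k ^ m k`. The identity must be adjoined because all `m k`
may vanish. -/
theorem exists_mem_adjoinOne_sq_eq {G : Subsemigroup (Matrix ι ι ℝ)}
    (hG : ∀ X ∈ G, ∀ Y ∈ G, X * Y = Y * X) {A B : Fin p → Matrix ι ι ℝ} (hA : ∀ k, A k ∈ G)
    (hBB : ∀ i j, Commute (B i) (B j)) (hAB : ∀ k, A k ^ 2 = NormedSpace.exp (B k))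
    (m : Fin p → ℕ) :
    ∃ X ∈ adjoinOne G, X ^ 2 = NormedSpace.exp (∑ k, (m k : ℝ) • B k) := by
  have : ∀ t : Finset (Fin p),
      ∃ X ∈ adjoinOne G, X ^ 2 = NormedSpace.exp (∑ k ∈ t, (m k : ℝ) • B k) := by
    intro t
    induction t using Finset.induction_on with
    | empty => exact ⟨1, one_mem _, by simp⟩
    | insert k t hk ih =>
      obtain ⟨X, hX, h⟩ := ih
      have hAk : A k ^ m k ∈ adjoinOne G := pow_mem (mem_adjoinOne.2 (Or.inr (hA k))) _
      refine ⟨A k ^ m k * X, mul_mem hAk hX, ?_⟩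
      rw [Finset.sum_insert hk, Matrix.exp_add_of_commute,
        (commute_of_mem_adjoinOne hG hAk hX).mul_pow, h, ← pow_mul, mul_comm (m k), pow_mul,
        hAB, ← Matrix.exp_nsmul, Nat.cast_smul_eq_nsmul]
      exact Commute.sum_right _ _ _ fun j _ => ((hBB k j).smul_left _).smul_right _
  exact this Finset.univ

end Powers

variable {n r s p : ℕ} (F : SpectralFrame (Fin n) r s)

/-- `{X ∈ K : exp X ∈ S}`. -/
def logs (S : Set (Matrix (Fin n) (Fin n) ℝ)) : Set (Matrix (Fin n) (Fin n) ℝ) :=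
  {X | NormedSpace.exp X ∈ S ∧ X ∈ F.K}

/-- `∑ ℕ B_k v₀` plus the vectors `D (0, 2πi t) v₀`. -/
def sumSet (B : Fin p → Matrix (Fin n) (Fin n) ℝ) : Set (Fin n → ℝ) :=
  {x | ∃ (m : Fin p → ℕ) (t : Fin s → ℤ),
    x = (∑ k, (m k : ℝ) • B k + F.D (period t)).mulVec F.v₀}

/-- A dense orbit of `v` spans, so some `X` in the linear span of `G` sends `v` to `v₀`. It commutes
with `G`, hence maps the orbit of `v` onto that of `v₀`. -/
theorem isHypercyclic_iff {G : Subsemigroup (Matrix (Fin n) (Fin n) ℝ)}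
    (hG : ∀ X ∈ G, ∀ Y ∈ G, X * Y = Y * X) (hGK : ∀ X ∈ G, X ∈ F.K) :
    IsHypercyclic (G : Set (Matrix (Fin n) (Fin n) ℝ)) ↔
      Dense (orbit (G : Set (Matrix (Fin n) (Fin n) ℝ)) F.v₀) := by
  refine ⟨?_, fun h => ⟨_, h⟩⟩
  rintro ⟨v, hv⟩
  have hspan := span_eq_top_of_dense hv
  have h0 : F.v₀ ∈ Submodule.map ((Matrix.mulVecBilin ℝ ℝ).flip v : _ →ₗ[ℝ] (Fin n → ℝ))
      (Submodule.span ℝ (G : Set (Matrix (Fin n) (Fin n) ℝ))) := by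
    rw [Submodule.map_span]
    change F.v₀ ∈ Submodule.span ℝ (orbit (G : Set (Matrix (Fin n) (Fin n) ℝ)) v)
    rw [hspan]; trivial
  obtain ⟨X, hX, hXv⟩ := h0
  change X.mulVec v = F.v₀ at hXv
  have hXK : X ∈ F.K := (Submodule.span_le (p := Subalgebra.toSubmodule F.K)).2 hGK hX
  have hXu : IsUnit X := by
    -- Applying `χ` to `X v = v₀` exhibits `χ v` as the inverse of the eigenvalues of `X`.
    refine F.isUnit_of_isUnit_eig hXK (IsUnit.of_mul_eq_one (F.χ v) ?_)
    rw [eig_apply, ← F.χ_mulVec X hXK, hXv, F.χ_v₀]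
  have hsurj : Function.Surjective X.mulVec := Matrix.mulVec_surjective_iff_isUnit.2 hXu
  have := hsurj.denseRange.dense_image (by fun_prop) hv
  convert this using 1
  rw [orbit, orbit, Set.image_image]
  refine Set.image_congr fun Y hY => ?_
  have hc : Commute Y X := commute_of_mem_span hX (hG Y hY)
  rw [← hXv, Matrix.mulVec_mulVec, Matrix.mulVec_mulVec, hc.eq]

/-- The sign pattern describes an open set, nonempty since it contains `D a v₀` for a suitable
vector `a` of signs. -/
theorem exists_mem_eig_neg {G : Subsemigroup (Matrix (Fin n) (Fin n) ℝ)}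
    (hd : Dense (orbit (G : Set (Matrix (Fin n) (Fin n) ℝ)) F.v₀)) (k : Fin r) :
    ∃ X ∈ G, (F.eig X).1 k < 0 ∧ ∀ i, i ≠ k → 0 < (F.eig X).1 i := by
  have hopen : IsOpen {x | (F.χ x).1 k < 0 ∧ ∀ i, i ≠ k → 0 < (F.χ x).1 i} := by
    have hc : ∀ i, Continuous fun x => (F.χ x).1 i := fun i =>
      (continuous_apply i).comp (continuous_fst.comp F.continuous_χ)
    refine (isOpen_lt (hc k) continuous_const).inter ?_
    change IsOpen {x | ∀ i, i ≠ k → 0 < (F.χ x).1 i}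
    simp only [Set.ofPred_forall]
    exact isOpen_iInter_of_finite fun i => isOpen_iInter_of_finite fun _ =>
      isOpen_lt continuous_const (hc i)
  obtain ⟨_, ⟨h1, h2⟩, X, hX, rfl⟩ := hd.inter_open_nonempty _ hopen
    ⟨(F.D (fun i => if i = k then -1 else 1, 0)).mulVec F.v₀, by
      simp only [Set.mem_ofPred_eq, F.χ_D]
      refine ⟨by simp, fun i hi => by simp [hi]⟩⟩
  exact ⟨X, hX, h1, h2⟩

theorem dense_orbit_logs {G : Subsemigroup (Matrix (Fin n) (Fin n) ℝ)}
    (hG : ∀ X ∈ G, ∀ Y ∈ G, X * Y = Y * X) (hGK : ∀ X ∈ G, X ∈ F.K)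
    (hd : Dense (orbit (G : Set (Matrix (Fin n) (Fin n) ℝ)) F.v₀)) :
    Dense (orbit (F.logs (squares G)) F.v₀) := by
  obtain ⟨T, hT⟩ := F.exists_cyclicAlgebra hGK hG (span_eq_top_of_dense hd)
  intro x
  rw [mem_closure_iff_nhds]
  intro U hU
  have h1 := T.image_expVec_mem_nhds hU
  -- The half of `x` provides a square root of `exp (Φ x)`: elements of `G` close to it have squares
  -- in the open image of `U`, and these squares have logarithms `Φ u` with `u ∈ U`.
  have hsq : ((T.Φ (T.expVec ((1 / 2 : ℝ) • x))) ^ 2).mulVec F.v₀ = T.expVec x := by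
    rw [T.Φ_expVec, map_smul, exp_smul_half_sq]; rfl
  have hc : Continuous fun y => ((T.Φ y) ^ 2).mulVec F.v₀ :=
    (T.continuous_Φ.pow 2).matrix_mulVec continuous_const
  rw [← hsq] at h1
  have h2 := hc.continuousAt.preimage_mem_nhds h1
  obtain ⟨_, hy, X, hX, rfl⟩ := mem_closure_iff_nhds.1 (hd (T.expVec ((1 / 2 : ℝ) • x))) _ h2
  have hX' : T.Φ (X.mulVec F.v₀) = X := hT X (hG X hX)
  obtain ⟨u, hu, hux⟩ := hy
  refine ⟨u, hu, T.Φ u, ⟨⟨X, hX, ?_⟩, T.mem_K u⟩, T.mulVec_v₀ u⟩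
  have h3 := congrArg T.Φ hux
  simp only [hX', T.Φ_expVec] at h3
  rw [h3]
  exact (T.Φ_mulVec _ fun y => by
    rw [← hX']; exact (T.commute _ y).pow_left 2).symm

/-! ### Sums of the chosen logarithms -/

section Sums

variable {F} {G : Subsemigroup (Matrix (Fin n) (Fin n) ℝ)}
  {B : Fin p → Matrix (Fin n) (Fin n) ℝ}

theorem commute_logs (hG : ∀ X ∈ G, ∀ Y ∈ G, X * Y = Y * X) (hGK : ∀ X ∈ G, X ∈ F.K)
    (hB : ∀ k, B k ∈ F.logs G) {X : Matrix (Fin n) (Fin n) ℝ} (hX : X ∈ G) (k : Fin p) :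
    Commute X (B k) :=
  F.commute_of_commute_exp (hGK X hX) (hB k).2 (hG X hX _ (hB k).1)

theorem commute_logs_logs (hG : ∀ X ∈ G, ∀ Y ∈ G, X * Y = Y * X) (hGK : ∀ X ∈ G, X ∈ F.K)
    (hB : ∀ k, B k ∈ F.logs G) (i j : Fin p) : Commute (B i) (B j) :=
  F.commute_of_commute_exp (hB i).2 (hB j).2 (commute_logs hG hGK hB (hB j).1 i).symm

theorem sum_smul_mem_K (hB : ∀ k, B k ∈ F.logs G) (m : Fin p → ℕ) :
    ∑ k, (m k : ℝ) • B k ∈ F.K :=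
  F.K.sum_mem fun k _ => F.K.smul_mem (hB k).2 _

variable {A : Fin p → Matrix (Fin n) (Fin n) ℝ}

theorem orbit_logs_subset_sumSet (hG : ∀ X ∈ G, ∀ Y ∈ G, X * Y = Y * X)
    (hGK : ∀ X ∈ G, X ∈ F.K)
    (hA : G = Subsemigroup.closure (Set.range A) ∨
      G = Subsemigroup.closure (insert 1 (Set.range A)))
    (hB : ∀ k, B k ∈ F.logs G) (hAB : ∀ k, A k ^ 2 = NormedSpace.exp (B k)) :
    orbit (F.logs (squares G)) F.v₀ ⊆ F.sumSet B := by
  rintro _ ⟨Z, ⟨⟨X, hX, hXZ⟩, hZ⟩, rfl⟩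
  obtain ⟨m, hm⟩ := exists_sq_eq_exp_sum_of_mem hG hA (commute_logs_logs hG hGK hB) hAB hX
  obtain ⟨t, rfl⟩ := F.exists_eq_add_period hZ (sum_smul_mem_K hB m) (hXZ.symm.trans hm)
  exact ⟨m, t, rfl⟩

theorem exists_mem_adjoinOne_of_mem_sumSet (hG : ∀ X ∈ G, ∀ Y ∈ G, X * Y = Y * X)
    (hGK : ∀ X ∈ G, X ∈ F.K) (hA : ∀ k, A k ∈ G)
    (hB : ∀ k, B k ∈ F.logs G) (hAB : ∀ k, A k ^ 2 = NormedSpace.exp (B k))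
    {x : Fin n → ℝ} (hx : x ∈ F.sumSet B) :
    ∃ Z ∈ F.K, ∃ X ∈ adjoinOne G, X ^ 2 = NormedSpace.exp Z ∧ x = Z.mulVec F.v₀ := by
  obtain ⟨m, t, rfl⟩ := hx
  obtain ⟨X, hX, h⟩ := exists_mem_adjoinOne_sq_eq hG hA (commute_logs_logs hG hGK hB) hAB m
  refine ⟨_, F.K.add_mem (sum_smul_mem_K hB m) (F.D_mem (period t)), X, hX, ?_, rfl⟩
  rw [h, F.exp_add_D_period (sum_smul_mem_K hB m)]

theorem dense_sumSet_diff [Nonempty (Fin n)] (hd : Dense (F.sumSet B)) :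
    Dense (F.sumSet B \ {x | ∃ t, x = (F.D (period t)).mulVec F.v₀}) := by
  -- The sum of the real parts of all coordinates vanishes on periods but equals `r + s` at `v₀`.
  -- Thus all periods lie in a hyperplane, whose open complement is dense.
  let φ : (Fin r → ℝ) × (Fin s → ℂ) →ₗ[ℝ] ℝ :=
    (∑ k, LinearMap.proj k) ∘ₗ LinearMap.fst ℝ _ _ +
      (∑ l, Complex.reLm ∘ₗ LinearMap.proj l) ∘ₗ LinearMap.snd ℝ _ _
  have hφ : ∀ a, φ a = ∑ k, a.1 k + ∑ l, (a.2 l).re := fun a => by simp [φ]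
  have hne : φ (F.χ F.v₀) ≠ 0 := by
    rw [F.χ_v₀, hφ]
    simp only [Prod.fst_one, Prod.snd_one, Pi.one_apply, Complex.one_re, Finset.sum_const,
      Finset.card_univ, Fintype.card_fin, nsmul_eq_mul, mul_one]
    intro h0
    have hrs : r = 0 ∧ s = 0 := by
      have : r + s = 0 := by exact_mod_cast h0
      lia
    obtain ⟨rfl, rfl⟩ := hrs
    -- Without any block, `D` would be defined on the zero ring and force `1 = 0`.
    have h1 : F.D 1 = F.D 0 := congrArg F.D (Subsingleton.elim _ _)
    rw [map_one, map_zero] at h1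
    exact one_ne_zero h1
  have hd2 := dense_ne_zero_of_linear (φ ∘ₗ F.χ) hne
  have hopen : IsOpen {x | (φ ∘ₗ F.χ) x ≠ 0} :=
    isOpen_ne_fun (LinearMap.continuous_of_finiteDimensional _) continuous_const
  refine (hd.inter_of_isOpen_right hd2 hopen).mono ?_
  rintro x ⟨hx1, hx2⟩
  refine ⟨hx1, ?_⟩
  rintro ⟨t, rfl⟩
  apply hx2
  rw [LinearMap.comp_apply, F.χ_D, hφ]
  simp [period]

theorem dense_orbit_logs_iff [Nonempty (Fin n)] (hG : ∀ X ∈ G, ∀ Y ∈ G, X * Y = Y * X)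
    (hGK : ∀ X ∈ G, X ∈ F.K)
    (hA : G = Subsemigroup.closure (Set.range A) ∨
      G = Subsemigroup.closure (insert 1 (Set.range A)))
    (hB : ∀ k, B k ∈ F.logs G) (hAB : ∀ k, A k ^ 2 = NormedSpace.exp (B k)) :
    Dense (orbit (F.logs (squares G)) F.v₀) ↔ Dense (F.sumSet B) := by
  refine ⟨fun h => h.mono (orbit_logs_subset_sumSet hG hGK hA hB hAB), fun h => ?_⟩
  refine (dense_sumSet_diff h).mono ?_
  rintro x ⟨hx, hx'⟩
  obtain ⟨Z, hZ, X, hX, hXZ, rfl⟩ :=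
    exists_mem_adjoinOne_of_mem_sumSet hG hGK (mem_of_eq_closure_range hA) hB hAB hx
  rcases hX with rfl | hX
  -- When the square root is the identity, which need not belong to `G`, the vector is one of the
  -- discarded periods.
  · exfalso
    obtain ⟨t, ht⟩ := F.exists_eq_add_period hZ F.K.zero_mem
      (by rw [← hXZ, one_pow, NormedSpace.exp_zero])
    exact hx' ⟨t, by rw [ht, zero_add]⟩
  · exact ⟨Z, ⟨⟨X, hX, hXZ⟩, hZ⟩, rfl⟩

theorem orbit_logs_eq_sumSet (hG : ∀ X ∈ G, ∀ Y ∈ G, X * Y = Y * X)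
    (hGK : ∀ X ∈ G, X ∈ F.K)
    (hA : G = Subsemigroup.closure (Set.range A) ∨
      G = Subsemigroup.closure (insert 1 (Set.range A)))
    (hB : ∀ k, B k ∈ F.logs G) (hAB : ∀ k, A k ^ 2 = NormedSpace.exp (B k)) (h1 : 1 ∈ G) :
    orbit (F.logs (squares G)) F.v₀ = F.sumSet B := by
  refine (orbit_logs_subset_sumSet hG hGK hA hB hAB).antisymm fun x hx => ?_
  obtain ⟨Z, hZ, X, hX, hXZ, rfl⟩ :=
    exists_mem_adjoinOne_of_mem_sumSet hG hGK (mem_of_eq_closure_range hA) hB hAB hx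
  have hX' : X ∈ G := by
    rcases hX with rfl | hX
    exacts [h1, hX]
  exact ⟨Z, ⟨⟨X, hX', hXZ⟩, hZ⟩, rfl⟩

/-- Multiplying by an element that is negative only at `k` flips exactly the `k`-th sign; the empty
pattern is realized by the identity. -/
theorem exists_mem_adjoinOne_sign (hGK : ∀ X ∈ G, X ∈ F.K)
    (hind : ∀ k, ∃ X ∈ G, (F.eig X).1 k < 0 ∧ ∀ i, i ≠ k → 0 < (F.eig X).1 i)
    (t : Finset (Fin r)) :
    ∃ X ∈ adjoinOne G, X ∈ F.K ∧
      ∀ i, (i ∈ t → (F.eig X).1 i < 0) ∧ (i ∉ t → 0 < (F.eig X).1 i) := by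
  induction t using Finset.induction_on with
  | empty => exact ⟨1, one_mem _, F.K.one_mem, fun i => by simp [F.eig_one]⟩
  | insert k t hk ih =>
    obtain ⟨X, hX, hXK, h⟩ := ih
    obtain ⟨Y, hY, h1, h2⟩ := hind k
    refine ⟨Y * X, mul_mem (mem_adjoinOne.2 (Or.inr hY)) hX, F.K.mul_mem (hGK Y hY) hXK,
      fun i => ?_⟩
    rw [F.eig_mul (hGK Y hY), Prod.fst_mul, Pi.mul_apply]
    by_cases hik : i = k
    · subst hik
      refine ⟨fun _ => mul_neg_of_neg_of_pos h1 ((h i).2 hk), fun hi => ?_⟩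
      simp at hi
    · refine ⟨fun hi => mul_neg_of_pos_of_neg (h2 i hik) ((h i).1 ?_),
        fun hi => mul_pos (h2 i hik) ((h i).2 ?_)⟩
      · simpa [hik] using hi
      · simpa [hik] using hi

theorem dense_orbit_of_dense_sumSet [Nonempty (Fin n)]
    (hG : ∀ X ∈ G, ∀ Y ∈ G, X * Y = Y * X) (hGK : ∀ X ∈ G, X ∈ F.K)
    (hA : ∀ k, A k ∈ G) (hB : ∀ k, B k ∈ F.logs G) (hAB : ∀ k, A k ^ 2 = NormedSpace.exp (B k))
    (hGU : ∀ X ∈ G, IsUnit X) (hd : Dense (F.sumSet B))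
    (hind : ∀ k, ∃ X ∈ G, (F.eig X).1 k < 0 ∧ ∀ i, i ≠ k → 0 < (F.eig X).1 i) :
    Dense (orbit (G : Set (Matrix (Fin n) (Fin n) ℝ)) F.v₀) := by
  have hBB := commute_logs_logs hG hGK hB
  -- Density of the orbit of `G` is not yet known, so the cyclic algebra is built from the `B k` and
  -- the centre `D`, whose span contains every logarithm occurring in the sums.
  set S : Set (Matrix (Fin n) (Fin n) ℝ) := Set.range B ∪ Set.range F.D
  have hSK : ∀ X ∈ S, X ∈ F.K := by
    rintro _ (⟨k, rfl⟩ | ⟨a, rfl⟩)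
    exacts [(hB k).2, F.D_mem a]
  have hSc : ∀ X ∈ F.K, (∀ k, Commute X (B k)) → ∀ Y ∈ S, Commute X Y := by
    rintro X hX h _ (⟨k, rfl⟩ | ⟨a, rfl⟩)
    exacts [h k, (F.D_commute X hX a).symm]
  have hS : ∀ X ∈ S, ∀ Y ∈ S, Commute X Y := by
    intro X hX
    refine hSc X (hSK X hX) fun k => ?_
    rcases hX with ⟨j, rfl⟩ | ⟨a, rfl⟩
    exacts [hBB j k, F.D_commute _ (hB k).2 a]
  have hsumspan : ∀ m t, ∑ k, ((m : Fin p → ℕ) k : ℝ) • B k + F.D (period t) ∈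
      Submodule.span ℝ S := fun m t =>
    add_mem (sum_mem fun k _ => Submodule.smul_mem _ _ (Submodule.subset_span (Or.inl ⟨k, rfl⟩)))
      (Submodule.subset_span (Or.inr ⟨_, rfl⟩))
  have hspan : Submodule.span ℝ
      ((fun X : Matrix (Fin n) (Fin n) ℝ => X.mulVec F.v₀) '' S) = ⊤ := by
    rw [eq_top_iff, ← span_eq_top_of_dense hd, Submodule.span_le]
    rintro _ ⟨m, t, rfl⟩
    have := Submodule.mem_map_of_mem
      (f := ((Matrix.mulVecBilin ℝ ℝ).flip F.v₀ : _ →ₗ[ℝ] (Fin n → ℝ))) (hsumspan m t)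
    rwa [Submodule.map_span] at this
  obtain ⟨T, hT⟩ := F.exists_cyclicAlgebra hSK hS hspan
  -- the closure of the set of squares contains the range of the exponential map
  set Q : Set (Fin n → ℝ) := (fun X : Matrix (Fin n) (Fin n) ℝ => (X ^ 2).mulVec F.v₀) ''
    (adjoinOne G : Set (Matrix (Fin n) (Fin n) ℝ))
  have hexpQ : Set.range T.expVec ⊆ closure Q := by
    refine (T.continuous_expVec.range_subset_closure_image_dense hd).trans (closure_mono ?_)
    rintro _ ⟨_, ⟨m, t, rfl⟩, rfl⟩
    obtain ⟨X, hX, h⟩ := exists_mem_adjoinOne_sq_eq hG hA hBB hAB m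
    refine ⟨X, hX, ?_⟩
    simp only [CyclicAlgebra.expVec]
    rw [hT, F.exp_add_D_period (sum_smul_mem_K hB m), h]
    intro Y hY
    exact (commute_of_mem_span (hsumspan m t) fun Z hZ => hS Y hY Z hZ).symm
  have hposQ : ∀ x, (∀ k, 0 < (F.χ x).1 k) → x ∈ closure Q := by
    intro x hx
    have hdense : Dense {y | ∀ l, ((F.χ y).2 l).im ≠ 0} := by
      have : {y | ∀ l, ((F.χ y).2 l).im ≠ 0} = ⋂ l, {y | ((F.χ y).2 l).im ≠ 0} := by
        ext; simp
      rw [this]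
      have hlin : ∀ l, Continuous fun y => ((F.χ y).2 l).im := fun l =>
        Complex.continuous_im.comp ((continuous_apply l).comp
          (continuous_snd.comp F.continuous_χ))
      refine dense_iInter_of_isOpen (fun l => isOpen_ne_fun (hlin l) continuous_const)
        fun l => ?_
      refine dense_ne_zero_of_linear (Complex.imLm ∘ₗ LinearMap.proj l ∘ₗ
        LinearMap.snd ℝ _ _ ∘ₗ F.χ) (v := (F.D (0, fun _ => Complex.I)).mulVec F.v₀) ?_
      simp [F.χ_D]
    have hopen : IsOpen {y | ∀ k, 0 < (F.χ y).1 k} := by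
      simp only [Set.ofPred_forall]
      exact isOpen_iInter_of_finite fun k => isOpen_lt continuous_const
        ((continuous_apply k).comp (continuous_fst.comp F.continuous_χ))
    have h1 := hdense.open_subset_closure_inter hopen hx
    -- Vectors with non-real complex eigenvalues are dense in the open positive region, and they are
    -- exponentials.
    refine closure_minimal ?_ isClosed_closure h1
    rintro y ⟨hy1, hy2⟩
    exact hexpQ (T.mem_range_expVec hy1 hy2)
  have hneO : ∀ x, (∀ k, (F.χ x).1 k ≠ 0) →
      x ∈ closure (insert F.v₀ (orbit (G : Set (Matrix (Fin n) (Fin n) ℝ)) F.v₀)) := by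
    classical
    intro x hx
    -- `X` is chosen with the signs of `x`, so that the preimage `y` of `x` under `X` has positive
    -- real eigenvalues.
    obtain ⟨X, hX, hXK, hsign⟩ := exists_mem_adjoinOne_sign hGK hind
      (Finset.univ.filter fun k => (F.χ x).1 k < 0)
    have hXU : IsUnit X := by
      rcases hX with rfl | h
      exacts [isUnit_one, hGU X h]
    obtain ⟨y, rfl⟩ := Matrix.mulVec_surjective_iff_isUnit.2 hXU x
    have hy : y ∈ closure Q := by
      refine hposQ y fun k => ?_
      have h1 := hx k
      have h2 := hsign k
      have hχ := F.χ_mulVec X hXK y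
      rw [← F.eig_apply] at hχ
      simp only [Finset.mem_filter, Finset.mem_univ, true_and, hχ, Prod.fst_mul,
        Pi.mul_apply] at h1 h2
      rcases lt_or_gt_of_ne h1 with h | h
      · exact pos_of_mul_neg_right h (h2.1 h).le
      · exact pos_of_mul_pos_right h (h2.2 h.not_gt).le
    have hcont : Continuous fun y : Fin n → ℝ => X.mulVec y := by fun_prop
    refine closure_mono ?_ (image_closure_subset_closure_image hcont ⟨y, hy, rfl⟩)
    rintro _ ⟨_, ⟨Y, hY, rfl⟩, rfl⟩
    have hm : X * Y ^ 2 ∈ adjoinOne G := mul_mem hX (pow_mem hY 2)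
    simp only [Matrix.mulVec_mulVec]
    rcases hm with h | h
    · rw [h, Matrix.one_mulVec]; exact Or.inl rfl
    · exact Or.inr ⟨_, h, rfl⟩
  have hins : Dense (insert F.v₀ (orbit (G : Set (Matrix (Fin n) (Fin n) ℝ)) F.v₀)) := by
    have hdense : Dense (⋂ k, {y | (F.χ y).1 k ≠ 0}) := by
      refine dense_iInter_of_isOpen (fun k => isOpen_ne_fun ((continuous_apply k).comp
        (continuous_fst.comp F.continuous_χ)) continuous_const) fun k => ?_
      refine dense_ne_zero_of_linear (LinearMap.proj k ∘ₗ LinearMap.fst ℝ _ _ ∘ₗ F.χ)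
        (v := F.v₀) ?_
      simp [F.χ_v₀]
    rw [← dense_closure]
    exact hdense.mono fun x hx => hneO x (by simpa using hx)
  -- The adjoined identity contributes only the point `v₀`, and deleting one point preserves density
  -- since `n ≥ 1`.
  have := hins.sdiff_singleton F.v₀
  exact this.mono (by rintro x ⟨rfl | hx, hne⟩ <;> [exact absurd rfl hne; exact hx])

end Sums

end SpectralFrame

end MatrixSemigroup

namespace MatrixSemigroup

open scoped Kronecker

/-! ### The spectral frame of the algebra of normal forms -/

/-- A nonzero entry of `X ^ k` requires its row to be at least `k` higher than its column, which is
impossible once `k` exceeds all heights. -/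
theorem isNilpotent_of_height {ι : Type*} [Fintype ι] [DecidableEq ι] {X : Matrix ι ι ℝ}
    (h : ι → ℕ) (hX : ∀ i j, X i j ≠ 0 → h j < h i) : IsNilpotent X := by
  have key : ∀ (k : ℕ) (i j), (X ^ k) i j ≠ 0 → h j + k ≤ h i := by
    intro k
    induction k with
    | zero =>
      intro i j hij
      by_cases e : i = j
      · simp [e]
      · simp [e] at hij
    | succ k ih =>
      intro i j hij
      rw [pow_succ', Matrix.mul_apply] at hij
      obtain ⟨l, _, hl⟩ := Finset.exists_ne_zero_of_sum_ne_zero hij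
      have h1 := hX i l (left_ne_zero_of_mul hl)
      have h2 := ih l j (right_ne_zero_of_mul hl)
      lia
  refine ⟨∑ i, h i + 1, ?_⟩
  ext i j
  by_contra hne
  have h1 := key _ i j hne
  have h2 := Finset.single_le_sum (f := h) (fun _ _ => Nat.zero_le _) (Finset.mem_univ i)
  lia

theorem mem_similitude_iff {C : Matrix (Fin 2) (Fin 2) ℝ} :
    C ∈ similitude ↔ C 0 0 = C 1 1 ∧ C 0 1 = -C 1 0 := by
  constructor
  · rintro ⟨α, β, rfl⟩; simp
  · rintro ⟨h1, h2⟩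
    refine ⟨C 1 1, C 0 1, ?_⟩
    ext i j
    fin_cases i <;> fin_cases j <;> simp [h1, h2]

/-- The algebra of lower triangular matrices with constant diagonal. -/
def triangularSubalgebra (m : ℕ) : Subalgebra ℝ (Matrix (Fin m) (Fin m) ℝ) where
  carrier := triangular m
  algebraMap_mem' c := by
    refine ⟨fun i j hij => ?_, c, fun i => ?_⟩
    · simp [Matrix.algebraMap_matrix_apply, hij.ne]
    · simp [Matrix.algebraMap_matrix_apply]
  add_mem' := by
    rintro M N ⟨hM, μ, hμ⟩ ⟨hN, ν, hν⟩
    exact ⟨fun i j hij => by simp [hM i j hij, hN i j hij], μ + ν, fun i => by simp [hμ, hν]⟩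
  mul_mem' := by
    rintro M N ⟨hM, μ, hμ⟩ ⟨hN, ν, hν⟩
    refine ⟨fun i j hij => ?_, μ * ν, fun i => ?_⟩
    · rw [Matrix.mul_apply]
      refine Finset.sum_eq_zero fun k _ => ?_
      rcases lt_or_ge i k with h | h
      · rw [hM i k h, zero_mul]
      · rw [hN k j (h.trans_lt hij), mul_zero]
    · rw [Matrix.mul_apply, Finset.sum_eq_single i, hμ, hν]
      · intro k _ hk
        rcases lt_or_gt_of_ne hk with h | h
        · rw [hN k i h, mul_zero]
        · rw [hM i k h, zero_mul]
      · simp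

theorem mem_cplxTriangular_iff {m : ℕ} {M : Matrix (Fin m × Fin 2) (Fin m × Fin 2) ℝ} :
    M ∈ cplxTriangular m ↔
      (∀ i j, M (i, 0) (j, 0) = M (i, 1) (j, 1) ∧ M (i, 0) (j, 1) = -M (i, 1) (j, 0)) ∧
      (∀ i j, i < j → ∀ a b, M (i, a) (j, b) = 0) ∧
      ∃ C : Matrix (Fin 2) (Fin 2) ℝ, ∀ i a b, M (i, a) (i, b) = C a b := by
  simp only [cplxTriangular, Set.mem_ofPred_eq, mem_similitude_iff, Matrix.of_apply]

/-- The algebra of block lower triangular matrices with blocks in `similitude` and with constant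
block diagonal. -/
def cplxTriangularSubalgebra (m : ℕ) :
    Subalgebra ℝ (Matrix (Fin m × Fin 2) (Fin m × Fin 2) ℝ) where
  carrier := cplxTriangular m
  algebraMap_mem' c := by
    refine mem_cplxTriangular_iff.2 ⟨fun i j => ?_, fun i j hij a b => ?_, c • 1, fun i a b => ?_⟩
    · simp [Matrix.algebraMap_matrix_apply]
    · simp [Matrix.algebraMap_matrix_apply, hij.ne]
    · simp [Matrix.algebraMap_matrix_apply, Matrix.one_apply]
  add_mem' := by
    intro M N hM hN
    obtain ⟨hM1, hM2, C, hC⟩ := mem_cplxTriangular_iff.1 hM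
    obtain ⟨hN1, hN2, C', hC'⟩ := mem_cplxTriangular_iff.1 hN
    refine mem_cplxTriangular_iff.2 ⟨fun i j => ?_, fun i j hij a b => ?_, C + C', fun i a b => ?_⟩
    · simp only [Matrix.add_apply, (hM1 i j).1, (hN1 i j).1, (hM1 i j).2, (hN1 i j).2, true_and]
      ring
    · simp [hM2 i j hij, hN2 i j hij]
    · simp [hC, hC']
  mul_mem' := by
    intro M N hM hN
    obtain ⟨hM1, hM2, C, hC⟩ := mem_cplxTriangular_iff.1 hM
    obtain ⟨hN1, hN2, C', hC'⟩ := mem_cplxTriangular_iff.1 hN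
    have hmul : ∀ i j a b, (M * N) (i, a) (j, b) =
        ∑ k, ∑ c, M (i, a) (k, c) * N (k, c) (j, b) := fun i j a b => by
      rw [Matrix.mul_apply, Fintype.sum_prod_type]
    refine mem_cplxTriangular_iff.2 ⟨fun i j => ?_, fun i j hij a b => ?_, C * C', fun i a b => ?_⟩
    · simp only [hmul, Fin.sum_univ_two, ← Finset.sum_neg_distrib]
      refine ⟨Finset.sum_congr rfl fun k _ => ?_, Finset.sum_congr rfl fun k _ => ?_⟩
      · rw [(hM1 i k).1, (hN1 k j).1, (hM1 i k).2, (hN1 k j).2]; ring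
      · rw [(hM1 i k).1, (hN1 k j).2, (hM1 i k).2, ← (hN1 k j).1]; ring
    · rw [hmul]
      refine Finset.sum_eq_zero fun k _ => Finset.sum_eq_zero fun c _ => ?_
      rcases lt_or_ge i k with h | h
      · rw [hM2 i k h, zero_mul]
      · rw [hN2 k j (h.trans_lt hij), mul_zero]
    · rw [hmul, Finset.sum_eq_single i]
      · simp only [hC, hC', Matrix.mul_apply]
      · intro k _ hk
        refine Finset.sum_eq_zero fun c _ => ?_
        rcases lt_or_gt_of_ne hk with h | h
        · rw [hN2 k i h, mul_zero]
        · rw [hM2 i k h, zero_mul]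
      · simp

/-- The block scalar matrix of a complex number, as a real matrix of order `2 * m`. -/
noncomputable def cplxScalar (m : ℕ) :
    ℂ →ₐ[ℝ] Matrix (Fin m × Fin 2) (Fin m × Fin 2) ℝ :=
  AlgHom.ofLinearMap
    { toFun := fun z => (1 : Matrix (Fin m) (Fin m) ℝ) ⊗ₖ
        Algebra.leftMulMatrix Complex.basisOneI z
      map_add' := fun z w => by rw [map_add, Matrix.kronecker_add]
      map_smul' := fun c z => by rw [map_smul, Matrix.kronecker_smul]; rfl }
    (by simp)
    (fun z w => by simp [← Matrix.mul_kronecker_mul])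

theorem cplxScalar_apply (m : ℕ) (z : ℂ) (x y : Fin m × Fin 2) :
    cplxScalar m z x y =
      if x.1 = y.1 then !![z.re, -z.im; z.im, z.re] x.2 y.2 else 0 := by
  change ((1 : Matrix (Fin m) (Fin m) ℝ) ⊗ₖ Algebra.leftMulMatrix Complex.basisOneI z) x y = _
  rw [Algebra.leftMulMatrix_complex, Matrix.kronecker_apply, Matrix.one_apply]
  split_ifs <;> simp

theorem cplxScalar_mem (m : ℕ) (z : ℂ) : cplxScalar m z ∈ cplxTriangular m := by
  refine mem_cplxTriangular_iff.2 ⟨fun i j => ?_, fun i j hij a b => ?_,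
    !![z.re, -z.im; z.im, z.re], fun i a b => ?_⟩
  · simp only [cplxScalar_apply]
    split_ifs <;> simp
  · simp [cplxScalar_apply, hij.ne]
  · simp [cplxScalar_apply]

/-- Matrices in `similitude` represent complex numbers, so the products commute block by block. -/
theorem cplxScalar_commute {m : ℕ} (z : ℂ) {M : Matrix (Fin m × Fin 2) (Fin m × Fin 2) ℝ}
    (hM : M ∈ cplxTriangular m) : Commute (cplxScalar m z) M := by
  obtain ⟨h1, -, -⟩ := mem_cplxTriangular_iff.1 hM
  ext ⟨i, a⟩ ⟨j, b⟩
  simp only [Matrix.mul_apply, Fintype.sum_prod_type, cplxScalar_apply, ite_mul, mul_ite,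
    zero_mul, mul_zero]
  rw [Finset.sum_eq_single i (by intro k _ hk; simp [hk.symm]) (by simp),
    Finset.sum_eq_single j (by intro k _ hk; simp [hk]) (by simp)]
  have ha := (h1 i j).1
  have hb := (h1 i j).2
  fin_cases a <;> fin_cases b <;> simp [ha, hb] <;> ring

/-! ### Block diagonal matrices in block coordinates -/

namespace BlockType

variable {n r s : ℕ} (η : BlockType n r s)

/-- The block diagonal matrices with triangular blocks, indexed by the block coordinates. -/
def blockAlgebra : Subalgebra ℝ (Matrix η.Idx η.Idx ℝ) where
  carrier := {M | ∃ (T : ∀ k, Matrix (Fin (η.realSize k)) (Fin (η.realSize k)) ℝ)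
      (B : ∀ l, Matrix (Fin (η.cplxSize l) × Fin 2) (Fin (η.cplxSize l) × Fin 2) ℝ),
    (∀ k, T k ∈ triangularSubalgebra (η.realSize k)) ∧
    (∀ l, B l ∈ cplxTriangularSubalgebra (η.cplxSize l)) ∧
    M = Matrix.fromBlocks (Matrix.blockDiagonal' T) 0 0 (Matrix.blockDiagonal' B)}
  algebraMap_mem' c := by
    refine ⟨algebraMap ℝ _ c, algebraMap ℝ _ c, fun k => ?_, fun l => ?_, ?_⟩
    · exact Subalgebra.algebraMap_mem _ c
    · exact Subalgebra.algebraMap_mem _ c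
    · simp only [Algebra.algebraMap_eq_smul_one, Matrix.blockDiagonal'_smul,
        Matrix.blockDiagonal'_one]
      rw [← Matrix.fromBlocks_one, Matrix.fromBlocks_smul, smul_zero, smul_zero]
  add_mem' := by
    rintro _ _ ⟨T, B, hT, hB, rfl⟩ ⟨T', B', hT', hB', rfl⟩
    refine ⟨T + T', B + B', fun k => add_mem (hT k) (hT' k), fun l => add_mem (hB l) (hB' l), ?_⟩
    rw [Matrix.fromBlocks_add, Matrix.blockDiagonal'_add, Matrix.blockDiagonal'_add]
    simp
  mul_mem' := by
    rintro _ _ ⟨T, B, hT, hB, rfl⟩ ⟨T', B', hT', hB', rfl⟩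
    refine ⟨fun k => T k * T' k, fun l => B l * B' l, fun k => mul_mem (hT k) (hT' k),
      fun l => mul_mem (hB l) (hB' l), ?_⟩
    rw [Matrix.fromBlocks_multiply, Matrix.blockDiagonal'_mul, Matrix.blockDiagonal'_mul]
    simp

/-- The block scalar matrices. -/
noncomputable def blockScalar :
    ((Fin r → ℝ) × (Fin s → ℂ)) →ₐ[ℝ] Matrix η.Idx η.Idx ℝ :=
  AlgHom.ofLinearMap
    { toFun := fun a => Matrix.fromBlocks
        (Matrix.blockDiagonal' fun k => algebraMap ℝ (Matrix (Fin (η.realSize k)) _ ℝ) (a.1 k)) 0 0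
        (Matrix.blockDiagonal' fun l => cplxScalar (η.cplxSize l) (a.2 l))
      map_add' := fun a b => by
        rw [Matrix.fromBlocks_add, ← Matrix.blockDiagonal'_add, ← Matrix.blockDiagonal'_add]
        simp only [Prod.fst_add, Prod.snd_add, Pi.add_apply, map_add, add_zero]
        rfl
      map_smul' := fun c a => by
        rw [RingHom.id_apply, Matrix.fromBlocks_smul, ← Matrix.blockDiagonal'_smul,
          ← Matrix.blockDiagonal'_smul, smul_zero, smul_zero]
        simp only [Prod.smul_fst, Prod.smul_snd, Pi.smul_apply, map_smul,
          Algebra.algebraMap_eq_smul_one, smul_eq_mul, mul_smul]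
        rfl }
    (by
      simp only [LinearMap.coe_mk, AddHom.coe_mk, Prod.fst_one, Prod.snd_one, Pi.one_apply,
        map_one]
      rw [← Matrix.fromBlocks_one]
      congr 1
      · exact Matrix.blockDiagonal'_one
      · exact Matrix.blockDiagonal'_one)
    (fun a b => by
      simp only [LinearMap.coe_mk, AddHom.coe_mk, Prod.fst_mul, Prod.snd_mul, Pi.mul_apply,
        map_mul]
      rw [Matrix.fromBlocks_multiply, Matrix.blockDiagonal'_mul, Matrix.blockDiagonal'_mul]
      simp)

theorem blockScalar_apply (a : (Fin r → ℝ) × (Fin s → ℂ)) :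
    η.blockScalar a = Matrix.fromBlocks
        (Matrix.blockDiagonal' fun k => algebraMap ℝ (Matrix (Fin (η.realSize k)) _ ℝ) (a.1 k)) 0 0
        (Matrix.blockDiagonal' fun l => cplxScalar (η.cplxSize l) (a.2 l)) := rfl

theorem blockScalar_mem (a) : η.blockScalar a ∈ η.blockAlgebra :=
  ⟨_, _, fun _ => Subalgebra.algebraMap_mem _ _, fun _ => cplxScalar_mem _ _, rfl⟩

theorem blockScalar_commute {X : Matrix η.Idx η.Idx ℝ} (hX : X ∈ η.blockAlgebra) (a) :
    Commute (η.blockScalar a) X := by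
  obtain ⟨T, B, -, hB, rfl⟩ := hX
  rw [blockScalar_apply, commute_iff_eq, Matrix.fromBlocks_multiply, Matrix.fromBlocks_multiply,
    ← Matrix.blockDiagonal'_mul, ← Matrix.blockDiagonal'_mul, ← Matrix.blockDiagonal'_mul,
    ← Matrix.blockDiagonal'_mul]
  simp only [Matrix.zero_mul, Matrix.mul_zero, add_zero, zero_add]
  congr 2
  · funext k; exact Algebra.commutes _ _
  · funext l; exact cplxScalar_commute _ (hB l)

/-- The first coordinate of the `k`-th real block. -/
abbrev realIdx (k : Fin r) : η.Idx := Sum.inl ⟨k, ⟨0, η.realSize_pos k⟩⟩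

/-- The first two coordinates of the `l`-th complex block. -/
abbrev cplxIdx (l : Fin s) (a : Fin 2) : η.Idx := Sum.inr ⟨l, ⟨0, η.cplxSize_pos l⟩, a⟩

/-- The first coordinates of the blocks of a vector. -/
noncomputable def leading : (η.Idx → ℝ) →ₗ[ℝ] (Fin r → ℝ) × (Fin s → ℂ) where
  toFun x := (fun k => x (η.realIdx k), fun l => ⟨x (η.cplxIdx l 0), x (η.cplxIdx l 1)⟩)
  map_add' x y := rfl
  map_smul' c x := by
    ext l
    · rfl
    · apply Complex.ext <;> simp

/-- The eigenvalues of a block diagonal matrix, read off from its diagonal blocks. -/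
def diagValues (X : Matrix η.Idx η.Idx ℝ) : (Fin r → ℝ) × (Fin s → ℂ) :=
  (fun k => X (η.realIdx k) (η.realIdx k),
    fun l => ⟨X (η.cplxIdx l 0) (η.cplxIdx l 0), X (η.cplxIdx l 1) (η.cplxIdx l 0)⟩)

/-- By lower triangularity, the first row of a block meets only its diagonal entry (or diagonal `2 ×
2` block). With coordinates `(x, y)` read as `x + iy`, the block `[α, β; -β, α]` acts as
multiplication by `α - iβ`. -/
theorem leading_mulVec {X : Matrix η.Idx η.Idx ℝ} (hX : X ∈ η.blockAlgebra) (v : η.Idx → ℝ) :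
    η.leading (X.mulVec v) = η.diagValues X * η.leading v := by
  obtain ⟨T, B, hT, hB, rfl⟩ := hX
  have hreal : ∀ k, (Matrix.fromBlocks (Matrix.blockDiagonal' T) 0 0
      (Matrix.blockDiagonal' B)).mulVec v (η.realIdx k) =
      T k ⟨0, η.realSize_pos k⟩ ⟨0, η.realSize_pos k⟩ * v (η.realIdx k) := by
    intro k
    rw [Matrix.mulVec, dotProduct, Finset.sum_eq_single (η.realIdx k)]
    · simp
    · rintro (⟨k', j⟩ | x) _ hne
      · by_cases hk : k = k'
        · subst hk
          have hj : (⟨0, η.realSize_pos k⟩ : Fin (η.realSize k)) < j := by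
            rw [Fin.lt_def]
            refine Nat.pos_of_ne_zero fun h0 => hne ?_
            congr 2
            exact Fin.ext h0
          simp [(hT k).1 _ _ hj]
        · simp [Matrix.blockDiagonal'_apply_ne _ _ _ hk]
      · simp
    · simp
  have hcplx : ∀ l a, (Matrix.fromBlocks (Matrix.blockDiagonal' T) 0 0
      (Matrix.blockDiagonal' B)).mulVec v (η.cplxIdx l a) =
      ∑ b, B l (⟨0, η.cplxSize_pos l⟩, a) (⟨0, η.cplxSize_pos l⟩, b) * v (η.cplxIdx l b) := by
    intro l a
    rw [Matrix.mulVec, dotProduct, Fintype.sum_sum_type, Finset.sum_eq_zero (by simp), zero_add,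
      Fintype.sum_sigma, Finset.sum_eq_single l, Fintype.sum_prod_type,
      Finset.sum_eq_single ⟨0, η.cplxSize_pos l⟩]
    · simp
    · intro j _ hj
      have hj' : (⟨0, η.cplxSize_pos l⟩ : Fin (η.cplxSize l)) < j := by
        rw [Fin.lt_def]
        exact Nat.pos_of_ne_zero fun h0 => hj (Fin.ext h0)
      refine Finset.sum_eq_zero fun b _ => ?_
      simp [(mem_cplxTriangular_iff.1 (hB l)).2.1 _ _ hj']
    · simp
    · intro l' _ hl
      refine Finset.sum_eq_zero fun x _ => ?_
      simp [Matrix.blockDiagonal'_apply_ne _ _ _ hl.symm]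
    · simp
  ext l
  · simp [leading, diagValues, hreal]
  · have h1 := (mem_cplxTriangular_iff.1 (hB l)).1 ⟨0, η.cplxSize_pos l⟩ ⟨0, η.cplxSize_pos l⟩
    apply Complex.ext
    · simp [leading, diagValues, hcplx, Fin.sum_univ_two, h1.2]; ring
    · simp [leading, diagValues, hcplx, Fin.sum_univ_two, h1.1]; ring

/-- The vector `u₀` in block coordinates. -/
def blockVec : η.Idx → ℝ := fun j => η.u₀ (η.idxEquiv j)

theorem leading_blockVec : η.leading η.blockVec = 1 := by
  ext l
  · simp [leading, blockVec, u₀]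
  · apply Complex.ext <;> simp [leading, blockVec, u₀]

theorem diagValues_blockScalar (a) : η.diagValues (η.blockScalar a) = a := by
  ext l
  · simp [diagValues, blockScalar_apply, Matrix.algebraMap_matrix_apply]
  · apply Complex.ext <;> simp [diagValues, blockScalar_apply, cplxScalar_apply]

theorem isNilpotent_of_diagValues {X : Matrix η.Idx η.Idx ℝ} (hX : X ∈ η.blockAlgebra)
    (h : η.diagValues X = 0) : IsNilpotent X := by
  obtain ⟨T, B, hT, hB, rfl⟩ := hX
  have hT0 : ∀ k i, T k i i = 0 := by
    intro k i
    obtain ⟨-, μ, hμ⟩ := hT k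
    have := congrFun (congrArg Prod.fst h) k
    simp only [diagValues, Matrix.fromBlocks_apply₁₁, Matrix.blockDiagonal'_apply_eq,
      Prod.fst_zero, Pi.zero_apply] at this
    rw [hμ, ← hμ ⟨0, η.realSize_pos k⟩, this]
  have hB0 : ∀ l i a b, B l (i, a) (i, b) = 0 := by
    intro l i a b
    obtain ⟨h1, -, C, hC⟩ := mem_cplxTriangular_iff.1 (hB l)
    have := congrFun (congrArg Prod.snd h) l
    simp only [diagValues, Matrix.fromBlocks_apply₂₂, Matrix.blockDiagonal'_apply_eq,
      Prod.snd_zero, Pi.zero_apply, Complex.ext_iff, Complex.zero_re, Complex.zero_im] at this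
    have h2 := h1 ⟨0, η.cplxSize_pos l⟩ ⟨0, η.cplxSize_pos l⟩
    simp only [hC] at this h2 ⊢
    fin_cases a <;> fin_cases b <;> simp <;> linarith [this.1, this.2, h2.1, h2.2]
  -- The height is the position inside a block; both rows of a `2 × 2` block share one height, as
  -- the diagonal `2 × 2` blocks vanish.
  refine isNilpotent_of_height (Sum.elim (fun x => (x.2 : ℕ)) fun x => (x.2.1 : ℕ)) ?_
  rintro (⟨k, i⟩ | ⟨l, i, a⟩) (⟨k', j⟩ | ⟨l', j, b⟩) hne
  · by_cases hk : k = k'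
    · subst hk
      simp only [Matrix.fromBlocks_apply₁₁, Matrix.blockDiagonal'_apply_eq] at hne
      simp only [Sum.elim_inl, ← Fin.lt_def]
      by_contra hij
      rcases eq_or_lt_of_le (not_lt.1 hij) with rfl | hlt
      · exact hne (hT0 k i)
      · exact hne ((hT k).1 i j hlt)
    · simp [Matrix.blockDiagonal'_apply_ne _ _ _ hk] at hne
  · simp at hne
  · simp at hne
  · by_cases hl : l = l'
    · subst hl
      simp only [Matrix.fromBlocks_apply₂₂, Matrix.blockDiagonal'_apply_eq] at hne
      simp only [Sum.elim_inr, ← Fin.lt_def]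
      by_contra hij
      rcases eq_or_lt_of_le (not_lt.1 hij) with rfl | hlt
      · exact hne (hB0 l i a b)
      · exact hne ((mem_cplxTriangular_iff.1 (hB l)).2.1 i j hlt a b)
    · simp [Matrix.blockDiagonal'_apply_ne _ _ _ hl] at hne

/-- Multiplication by `i` takes the first coordinate vector of a complex block to the second, which
links periods to the vectors `f`. -/
theorem blockScalar_mulVec_blockVec (l : Fin s) :
    (η.blockScalar (0, Pi.single l Complex.I)).mulVec η.blockVec =
      fun j => η.f l (η.idxEquiv j) := by
  funext j
  rcases j with ⟨k, i⟩ | ⟨l', i, a⟩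
  · rw [blockScalar_apply, Matrix.fromBlocks_mulVec]
    have : (Matrix.blockDiagonal' fun k =>
        (0 : Matrix (Fin (η.realSize k)) (Fin (η.realSize k)) ℝ)) = 0 :=
      Matrix.blockDiagonal'_zero
    simp [this, f]
  · rw [Matrix.mulVec, dotProduct, Finset.sum_eq_single (η.cplxIdx l' 0)]
    · simp only [blockScalar_apply, Matrix.fromBlocks_apply₂₂, Matrix.blockDiagonal'_apply_eq,
        cplxScalar_apply, blockVec, u₀, f, Equiv.symm_apply_apply, Sum.elim_inr]
      by_cases hl : l' = l
      · subst hl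
        by_cases hi : (i : ℕ) = 0
        · fin_cases a <;> simp [hi, Fin.ext_iff]
        · simp [hi, Fin.ext_iff]
      · fin_cases a <;> simp [hl]
    · rintro (x | ⟨l'', j, b⟩) _ hne
      · simp [blockScalar_apply]
      · by_cases hl : l' = l''
        · subst hl
          have : ¬((j : ℕ) = 0 ∧ b = 0) := by
            rintro ⟨hj, rfl⟩
            exact hne (by congr 3; exact Fin.ext hj)
          simp only [blockVec, u₀, Equiv.symm_apply_apply, Sum.elim_inr, if_neg this, mul_zero]
        · simp [blockScalar_apply, Matrix.blockDiagonal'_apply_ne _ _ _ hl]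
    · simp

/-! ### Conjugation by `P` and the frame of the normal forms -/

/-- Conjugation by `P`, followed by the passage to block coordinates. -/
def blockEquiv (P : GL (Fin n) ℝ) :
    Matrix (Fin n) (Fin n) ℝ ≃ₐ[ℝ] Matrix η.Idx η.Idx ℝ :=
  AlgEquiv.trans
    (AlgEquiv.ofLinearEquiv
      { toFun := conj P
        invFun := fun M => P.val * M * (P⁻¹ : GL (Fin n) ℝ).val
        map_add' := fun M N => by simp [conj, mul_add, add_mul]
        map_smul' := fun c M => by simp [conj]
        left_inv := fun M => by simp [conj, mul_assoc]
        right_inv := fun M => by simp [conj, mul_assoc] }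
      (by simp [conj])
      (fun M N => by simp [conj, mul_assoc]))
    (Matrix.reindexAlgEquiv ℝ ℝ η.idxEquiv.symm)

theorem blockEquiv_mem_iff (P : GL (Fin n) ℝ) (M : Matrix (Fin n) (Fin n) ℝ) :
    η.blockEquiv P M ∈ η.blockAlgebra ↔ conj P M ∈ η.normalForms := by
  have h : ∀ X : Matrix η.Idx η.Idx ℝ,
      η.blockEquiv P M = X ↔ conj P M = Matrix.reindex η.idxEquiv η.idxEquiv X := by
    intro X
    rw [← Equiv.symm_apply_eq]
    rfl
  constructor
  · rintro ⟨T, B, hT, hB, hX⟩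
    exact ⟨T, B, hT, hB, (h _).1 hX⟩
  · rintro ⟨T, B, hT, hB, hX⟩
    exact ⟨T, B, hT, hB, (h _).2 hX⟩

/-- The coordinates of `P⁻¹ x`, sorted by blocks. -/
def blockCoords (P : GL (Fin n) ℝ) : (Fin n → ℝ) →ₗ[ℝ] (η.Idx → ℝ) :=
  LinearMap.funLeft ℝ ℝ η.idxEquiv ∘ₗ Matrix.mulVecLin (P⁻¹ : GL (Fin n) ℝ).val

theorem blockCoords_mulVec (P : GL (Fin n) ℝ) (M : Matrix (Fin n) (Fin n) ℝ) (v : Fin n → ℝ) :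
    η.blockCoords P (M.mulVec v) = (η.blockEquiv P M).mulVec (η.blockCoords P v) := by
  have h : (P⁻¹ : GL (Fin n) ℝ).val.mulVec (M.mulVec v) =
      (conj P M).mulVec ((P⁻¹ : GL (Fin n) ℝ).val.mulVec v) := by
    simp only [conj, Matrix.mulVec_mulVec, mul_assoc, Units.mul_inv, mul_one]
  funext i
  change (P⁻¹ : GL (Fin n) ℝ).val.mulVec (M.mulVec v) (η.idxEquiv i) = _
  rw [h]
  exact (Equiv.sum_comp η.idxEquiv _).symm

theorem blockCoords_injective (P : GL (Fin n) ℝ) : Function.Injective (η.blockCoords P) := by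
  intro x y h
  have h1 : (P⁻¹ : GL (Fin n) ℝ).val.mulVec x = (P⁻¹ : GL (Fin n) ℝ).val.mulVec y :=
    η.idxEquiv.surjective.injective_comp_right h
  have h2 := congrArg P.val.mulVec h1
  simpa [Matrix.mulVec_mulVec] using h2

theorem blockCoords_P_mulVec (P : GL (Fin n) ℝ) (x : Fin n → ℝ) :
    η.blockCoords P (P.val.mulVec x) = fun j => x (η.idxEquiv j) := by
  funext j
  change (P⁻¹ : GL (Fin n) ℝ).val.mulVec (P.val.mulVec x) (η.idxEquiv j) = _
  simp [Matrix.mulVec_mulVec]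

theorem blockCoords_v₀ (P : GL (Fin n) ℝ) : η.blockCoords P (η.v₀ P) = η.blockVec :=
  η.blockCoords_P_mulVec P η.u₀

/-- The spectral frame of `P 𝒦_{η,r,s}(ℝ) P⁻¹`. -/
noncomputable def frame (P : GL (Fin n) ℝ) : SpectralFrame (Fin n) r s where
  K := η.blockAlgebra.comap (η.blockEquiv P : _ →ₐ[ℝ] Matrix η.Idx η.Idx ℝ)
  χ := η.leading ∘ₗ η.blockCoords P
  D := ((η.blockEquiv P).symm : _ →ₐ[ℝ] Matrix (Fin n) (Fin n) ℝ).comp η.blockScalar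
  v₀ := η.v₀ P
  χ_mulVec X hX v := by
    have hX' : η.blockEquiv P X ∈ η.blockAlgebra := hX
    simp only [LinearMap.comp_apply, blockCoords_mulVec, η.leading_mulVec hX', blockCoords_v₀,
      leading_blockVec, mul_one]
  D_mem a := by
    change η.blockEquiv P ((η.blockEquiv P).symm (η.blockScalar a)) ∈ η.blockAlgebra
    rw [AlgEquiv.apply_symm_apply]
    exact η.blockScalar_mem a
  D_commute X hX a := by
    have h := (η.blockScalar_commute hX a).map (η.blockEquiv P).symm
    have h2 : (η.blockEquiv P).symm ((η.blockEquiv P) X) = X := AlgEquiv.symm_apply_apply _ _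
    change Commute _ ((η.blockEquiv P).symm ((η.blockEquiv P) X)) at h
    rw [h2] at h
    exact h
  χ_D a := by
    change η.leading (η.blockCoords P
      (((η.blockEquiv P).symm (η.blockScalar a)).mulVec (η.v₀ P))) = a
    rw [blockCoords_mulVec, AlgEquiv.apply_symm_apply, η.leading_mulVec (η.blockScalar_mem a),
      blockCoords_v₀, leading_blockVec, mul_one, diagValues_blockScalar]
  isNilpotent X hX h := by
    have hX' : η.blockEquiv P X ∈ η.blockAlgebra := hX
    rw [LinearMap.comp_apply, blockCoords_mulVec, η.leading_mulVec hX', blockCoords_v₀,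
      leading_blockVec, mul_one] at h
    exact (IsNilpotent.map_iff (η.blockEquiv P).injective).1
      (η.isNilpotent_of_diagValues hX' h)

theorem mem_frame_K (P : GL (Fin n) ℝ) (M : Matrix (Fin n) (Fin n) ℝ) :
    M ∈ (η.frame P).K ↔ conj P M ∈ η.normalForms := η.blockEquiv_mem_iff P M

theorem logs_eq_frame_logs (P : GL (Fin n) ℝ) (S : Set (Matrix (Fin n) (Fin n) ℝ)) :
    η.logs P S = (η.frame P).logs S := by
  ext M
  exact and_congr_right fun _ => (η.mem_frame_K P M).symm

theorem realEigenvalue_conj (P : GL (Fin n) ℝ) {M : Matrix (Fin n) (Fin n) ℝ}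
    (hM : M ∈ (η.frame P).K) (k : Fin r) :
    η.realEigenvalue (conj P M) k = ((η.frame P).eig M).1 k := by
  have hM' : η.blockEquiv P M ∈ η.blockAlgebra := hM
  change _ = (η.leading (η.blockCoords P (M.mulVec (η.v₀ P)))).1 k
  rw [blockCoords_mulVec, η.leading_mulVec hM', blockCoords_v₀, leading_blockVec, mul_one]
  rfl

theorem frame_D_mulVec (P : GL (Fin n) ℝ) (l : Fin s) :
    ((η.frame P).D (0, Pi.single l Complex.I)).mulVec (η.v₀ P) = P.val.mulVec (η.f l) := by
  apply η.blockCoords_injective P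
  rw [blockCoords_P_mulVec, blockCoords_mulVec, blockCoords_v₀]
  change (η.blockEquiv P ((η.blockEquiv P).symm (η.blockScalar _))).mulVec _ = _
  rw [AlgEquiv.apply_symm_apply, blockScalar_mulVec_blockVec]

theorem sumSemigroup_eq_sumSet (P : GL (Fin n) ℝ) {p : ℕ}
    (B : Fin p → Matrix (Fin n) (Fin n) ℝ) :
    (η.sumSemigroup P B : Set (Fin n → ℝ)) = (η.frame P).sumSet B := by
  ext x
  refine exists_congr fun m => exists_congr fun t => ?_
  -- A period is the real combination, with coefficients `2π t l`, of the units `i` of the complex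
  -- factors; `D` sends these to matrices taking `v₀` to `P f`.
  have h1 : (SpectralFrame.period t : (Fin r → ℝ) × (Fin s → ℂ)) =
      ∑ l, (2 * Real.pi * (t l : ℝ)) • ((0, Pi.single l Complex.I) :
        (Fin r → ℝ) × (Fin s → ℂ)) := by
    ext l
    · simp [SpectralFrame.period, Prod.fst_sum]
    · simp only [SpectralFrame.period, Prod.snd_sum, Prod.smul_snd, Finset.sum_apply,
        Pi.smul_apply]
      rw [Finset.sum_eq_single l]
      · simp; ring
      · intro j _ hj; simp [hj.symm]
      · simp
  have h2 : ((η.frame P).D (SpectralFrame.period t)).mulVec (η.v₀ P) =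
      ∑ l, (2 * Real.pi * (t l : ℝ)) • P.val.mulVec (η.f l) := by
    rw [h1, map_sum, Matrix.sum_mulVec]
    refine Finset.sum_congr rfl fun l _ => ?_
    rw [map_smul, Matrix.smul_mulVec, frame_D_mulVec]
  change _ ↔ x = (∑ k, (m k : ℝ) • B k + (η.frame P).D (SpectralFrame.period t)).mulVec (η.v₀ P)
  rw [Matrix.add_mulVec, h2, Matrix.sum_mulVec]
  simp only [Matrix.smul_mulVec]

theorem index_eq_iff (P : GL (Fin n) ℝ) {G : Set (Matrix (Fin n) (Fin n) ℝ)}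
    (hGK : ∀ X ∈ G, X ∈ (η.frame P).K) (hGU : ∀ X ∈ G, IsUnit X) :
    η.index P G = r ↔ ∀ k, ∃ X ∈ G, ((η.frame P).eig X).1 k < 0 ∧
      ∀ i, i ≠ k → 0 < ((η.frame P).eig X).1 i := by
  have h : {k : Fin r | ∃ M ∈ G, IsUnit M ∧ η.realEigenvalue (conj P M) k < 0 ∧
      ∀ i, i ≠ k → 0 < η.realEigenvalue (conj P M) i} =
      {k | ∃ X ∈ G, ((η.frame P).eig X).1 k < 0 ∧
        ∀ i, i ≠ k → 0 < ((η.frame P).eig X).1 i} := by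
    ext k
    refine exists_congr fun X => and_congr_right fun hX => ?_
    simp only [η.realEigenvalue_conj P (hGK X hX), hGU X hX, true_and]
  rw [index, h]
  constructor
  · intro hr k
    -- A subset of `Fin r` with `r` elements is everything.
    have huniv := Set.eq_of_subset_of_ncard_le (Set.subset_univ _)
      (by rw [hr, Set.ncard_univ, Nat.card_fin])
    have hk := Set.mem_univ k
    rwa [← huniv] at hk
  · intro hall
    rw [show {k | _} = Set.univ from Set.eq_univ_of_forall hall, Set.ncard_univ, Nat.card_fin]

end BlockType

end MatrixSemigroup

theorem corollary1p4 {n r s p : ℕ} (hn : 1 ≤ n) (η : BlockType n r s)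
    (G : Subsemigroup (Matrix (Fin n) (Fin n) ℝ))
    (hG : ∀ X ∈ G, ∀ Y ∈ G, X * Y = Y * X)
    (P : GL (Fin n) ℝ)
    (hP : ∀ X ∈ G, BlockType.conj P X ∈ η.normalForms)
    (A : Fin p → Matrix (Fin n) (Fin n) ℝ)
    -- `A₁, …, A_p` generate `G`, without or with the identity matrix
    (hA : G = Subsemigroup.closure (Set.range A) ∨
      G = Subsemigroup.closure (insert 1 (Set.range A)))
    (B : Fin p → Matrix (Fin n) (Fin n) ℝ)
    (hB : ∀ k, B k ∈ η.logs P G)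
    (hAB : ∀ k, A k ^ 2 = NormedSpace.exp (B k)) :
    -- `g²_{v₀} = ∑ ℕ B_k v₀ + ∑ 2πℤ P f^{(l)}`, as soon as `G` contains the identity matrix
    ((1 : Matrix (Fin n) (Fin n) ℝ) ∈ G →
      orbit (η.logs P (squares G)) (η.v₀ P) = η.sumSemigroup P B) ∧
    List.TFAE [
      IsHypercyclic (G : Set (Matrix (Fin n) (Fin n) ℝ)),
      Dense (orbit (G : Set (Matrix (Fin n) (Fin n) ℝ)) (η.v₀ P)),
      Dense (orbit (η.logs P (squares G)) (η.v₀ P)) ∧ η.index P G = r,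
      Dense (η.sumSemigroup P B : Set (Fin n → ℝ)) ∧ η.index P G = r] := by
  have : Nonempty (Fin n) := ⟨⟨0, hn⟩⟩
  have hGK : ∀ X ∈ G, X ∈ (η.frame P).K := fun X hX => (η.mem_frame_K P X).2 (hP X hX)
  have hB' : ∀ k, B k ∈ (η.frame P).logs G := fun k => η.logs_eq_frame_logs P G ▸ hB k
  have hBB := SpectralFrame.commute_logs_logs hG hGK hB'
  -- Every square of an element of `G` is an exponential, so the invertibility demanded in the index
  -- is automatic.
  have hGU : ∀ X ∈ G, IsUnit X := fun X hX => by
    obtain ⟨m, hm⟩ := SpectralFrame.exists_sq_eq_exp_sum_of_mem hG hA hBB hAB hX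
    exact (isUnit_pow_iff two_ne_zero).1 (hm ▸ Matrix.isUnit_exp _)
  have hind := η.index_eq_iff P hGK hGU
  have hv : η.v₀ P = (η.frame P).v₀ := rfl
  rw [η.sumSemigroup_eq_sumSet, η.logs_eq_frame_logs, hind, hv]
  refine ⟨SpectralFrame.orbit_logs_eq_sumSet hG hGK hA hB' hAB, ?_⟩
  tfae_have 1 ↔ 2 := (η.frame P).isHypercyclic_iff hG hGK
  tfae_have 2 → 3 := fun h => ⟨(η.frame P).dense_orbit_logs hG hGK h,
    (η.frame P).exists_mem_eig_neg h⟩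
  tfae_have 3 ↔ 4 := and_congr_left fun _ =>
    SpectralFrame.dense_orbit_logs_iff hG hGK hA hB' hAB
  tfae_have 4 → 2 := fun h => SpectralFrame.dense_orbit_of_dense_sumSet hG hGK
    (SpectralFrame.mem_of_eq_closure_range hA) hB' hAB hGU h.1 h.2
  tfae_finish
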